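/- **Setting.** Let $Z\subset\mathbb R^d$ be a convex body (compact, convex, non-empty interior), let $\delta(x,y)=N(x-y)$ be the metric induced by a norm $N$ on $\mathbb R^d$, and let $g:Z\to\mathbb R^D$ be differentiable and injective (latent states $z$ are observed as $x=g(z)$). Let $A_1,\dots,A_L\in\mathbb R^{d\times d}$ be invertible, and for $w=(w_1,\dots,w_L)$ write $f_A(w)=\sum_{\tau=1}^L A_\tau w_\tau$. The history $z_H=(z_{t-1},\dots,z_{t-L})$ is a random element of $Z^L$ whose law has a density on $(\mathbb R^d)^L$ and for which the noiseless transition $\tilde z=f_A(z_H)$ is uniformly distributed on $Z$. Given the history, the current state $z_t$ has on $Z$ the density $$p(z\mid z_H)=C_p(\tilde z)^{-1}e^{-\delta(z,\tilde z)},\qquad C_p(\tilde z)=\int_Z e^{-\delta(z,\tilde z)}\,dz .$$ **Models and objective.** A model is a pair $(r,f)$ where $r$ belongs to a class $\mathcal R$ of measurable encoders $\mathbb R^D\to Z$ that contains all continuous ones, and $f=f_{\hat A}$ for some invertible $\hat A_1,\dots,\hat A_L$. Put $h=r\circ g:Z\to Z$. Let $\mu>0$ be a temperature with $\mu Z\subseteq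 Z$ (for example $\mu=1$). With $\hat z=h(z_t)$, $\tilde z_f=f\bigl(h(z_{t-1}),\dots,h(z_{t-L})\bigr)$, and $\hat z_i^-=h(z_i^-)$ for independent $z_1^-,\dots,z_M^-$ that are uniform on $Z$ and independent of $(z_H,z_t)$, the contrastive loss is $$\mathcal L(r,f;\mu,M)=\mathbb E\left[-\log\frac{e^{-\delta(\tilde z_f,\hat z)/\mu}}{e^{-\delta(\tilde z_f,\hat z)/\mu}+\sum_{i=1}^M e^{-\delta(\tilde z_f,\hat z_i^-)/\mu}}\right].$$ **Theorem.** Suppose that $(r,f)$ minimizes $\lim_{M\to\infty}\bigl(\mathcal L(r,f;\mu,M)-\log M\bigr)$ over all models. Then there are an invertible matrix $U\in\mathbb R^{d\times d}$ and $b\in\mathbb R^d$ with $N(Ux)=\mu N(x)$ for all $x$, such that: 1. $z\mapsto Uz+b$ maps $Z$ into $Z$, and $h(z)=Uz+b$ for almost every $z\in Z$, and for every $z\in Z$ if $h$ is continuous. So $h$ is an invertible affine map. If $\mu=1$, then $z\mapsto Uz+b$ is a bijection of $Z$ onto $Z$ and a $\delta$-isometry, and $b=0$ if the barycentre of $Z$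 is the origin. 2. If $N$ is an $\ell^p$ norm with $1\le p\le\infty$, then $\mu^{-1}U$ is orthogonal (so $U$ is orthogonal if $\mu=1$). 3. $f$ recovers the ground-truth transition in the new coordinates: $\hat A_\tau=UA_\tau U^{-1}$ for all $\tau$ (equivalently $U^{-1}\hat A_\tau=A_\tau U^{-1}$), and $f(Uw_1+b,\dots,Uw_L+b)=U f_A(w_1,\dots,w_L)+b$ for all $w_1,\dots,w_L\in\mathbb R^d$. -/

import Mathlib

open MeasureTheory Set Filter Topology
open scoped Matrix ENNReal

noncomputable section

namespace ContrastiveVAR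

/-- The noiseless vector-autoregressive transition
`(w_1, …, w_L) ↦ ∑ τ, A_τ w_τ`, where `w_τ` is the state `τ` steps back. -/
def transition {d L : ℕ} (A : Fin L → Matrix (Fin d) (Fin d) ℝ)
    (w : Fin L → Fin d → ℝ) : Fin d → ℝ :=
  ∑ τ, A τ *ᵥ w τ

/-- The uniform probability distribution on `Z`. -/
def uniformLaw {d : ℕ} (Z : Set (Fin d → ℝ)) : Measure (Fin d → ℝ) :=
  (volume Z)⁻¹ • volume.restrict Z

/-- The normalizing constant `C_p(c) = ∫_Z exp (-δ(z, c)) dz`, with `δ(z, c) = N (z - c)`. -/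
def partitionFn {d : ℕ} (N : Seminorm ℝ (Fin d → ℝ)) (Z : Set (Fin d → ℝ))
    (c : Fin d → ℝ) : ℝ :=
  ∫ z in Z, Real.exp (-N (z - c))

/-- The ground-truth conditional density of the current state `z` on `Z` given the
history `w`: `p(z | w) = C_p(z̃)⁻¹ exp (-δ(z, z̃))` with `z̃ = ∑ τ, A_τ w_τ`. -/
def condDensity {d L : ℕ} (N : Seminorm ℝ (Fin d → ℝ)) (Z : Set (Fin d → ℝ))
    (A : Fin L → Matrix (Fin d) (Fin d) ℝ) (w : Fin L → Fin d → ℝ) (z : Fin d → ℝ) : ℝ :=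
  Real.exp (-N (z - transition A w)) / partitionFn N Z (transition A w)

/-- The joint law of (history, current state): the history has law `ρ`, and given the
history `w` the current state has density `condDensity N Z A w` on `Z`. -/
def positiveLaw {d L : ℕ} (N : Seminorm ℝ (Fin d → ℝ)) (Z : Set (Fin d → ℝ))
    (A : Fin L → Matrix (Fin d) (Fin d) ℝ) (ρ : Measure (Fin L → Fin d → ℝ)) :
    Measure ((Fin L → Fin d → ℝ) × (Fin d → ℝ)) :=
  (ρ.prod (volume.restrict Z)).withDensity
    fun p => ENNReal.ofReal (condDensity N Z A p.1 p.2)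

/-- The critic `exp (-δ(f(r(x_{t-1}), …, r(x_{t-L})), r(x)) / μ)` with `x_{t-τ} = g (w_τ)`,
`x = g z`: it compares the transition `f` with matrices `B`, applied to the encoded history,
with the encoded state. -/
def critic {d L D : ℕ} (N : Seminorm ℝ (Fin d → ℝ))
    (g : (Fin d → ℝ) → EuclideanSpace ℝ (Fin D)) (μ : ℝ)
    (r : EuclideanSpace ℝ (Fin D) → Fin d → ℝ) (B : Fin L → Matrix (Fin d) (Fin d) ℝ)
    (w : Fin L → Fin d → ℝ) (z : Fin d → ℝ) : ℝ :=
  Real.exp (-N (transition B (fun τ => r (g (w τ))) - r (g z)) / μ)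

/-- The contrastive loss with `M` negatives of the encoder `r` and of the transition with
matrices `B`. The positive pair is drawn from `positiveLaw`, the negatives are
observations `g (n i)` of independent uniform latent states. -/
def contrastiveLoss {d L D : ℕ} (N : Seminorm ℝ (Fin d → ℝ)) (Z : Set (Fin d → ℝ))
    (A : Fin L → Matrix (Fin d) (Fin d) ℝ) (ρ : Measure (Fin L → Fin d → ℝ))
    (g : (Fin d → ℝ) → EuclideanSpace ℝ (Fin D)) (μ : ℝ) (M : ℕ)
    (r : EuclideanSpace ℝ (Fin D) → Fin d → ℝ) (B : Fin L → Matrix (Fin d) (Fin d) ℝ) : ℝ :=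
  ∫ p, ∫ n : Fin M → Fin d → ℝ,
      -Real.log (critic N g μ r B p.1 p.2 /
        (critic N g μ r B p.1 p.2 + ∑ i, critic N g μ r B p.1 (n i)))
    ∂(Measure.pi fun _ => uniformLaw Z) ∂(positiveLaw N Z A ρ)

/-- The contrastive objective for `M → ∞`: the limit of the loss normalized by `log M`,
written as an upper limit in the extended reals so that it is always meaningful. -/
def asymptoticLoss {d L D : ℕ} (N : Seminorm ℝ (Fin d → ℝ)) (Z : Set (Fin d → ℝ))
    (A : Fin L → Matrix (Fin d) (Fin d) ℝ) (ρ : Measure (Fin L → Fin d → ℝ))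
    (g : (Fin d → ℝ) → EuclideanSpace ℝ (Fin D)) (μ : ℝ)
    (m : (EuclideanSpace ℝ (Fin D) → Fin d → ℝ) × (Fin L → Matrix (Fin d) (Fin d) ℝ)) : EReal :=
  limsup (fun M : ℕ =>
    ((contrastiveLoss N Z A ρ g μ M m.1 m.2 - Real.log M : ℝ) : EReal)) atTop

/-- The models: an encoder from the class `R`, and a transition with full-rank matrices. -/
def models {d L D : ℕ} (R : Set (EuclideanSpace ℝ (Fin D) → Fin d → ℝ)) :
    Set ((EuclideanSpace ℝ (Fin D) → Fin d → ℝ) × (Fin L → Matrix (Fin d) (Fin d) ℝ)) :=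
  {m | m.1 ∈ R ∧ ∀ τ, IsUnit (m.2 τ).det}

end ContrastiveVAR

end

/-! By the law of large numbers the loss minus `log M` converges to the cross entropy, under the
true law, of the conditional density proportional to the critic (`tendsto_contrastive_loss`). Since
`μ • Z ⊆ Z`, the encoder inducing `z ↦ μ • z` with the true matrices is an admissible model whose
critic is exactly `exp (-δ(z, z̃))`, so the true density is attained. The equality case of Gibbs'
inequality (`ae_eq_of_integral_log_le`) forces every minimizer to reproduce that density almost
everywhere. Taking logarithms and comparing two states removes the normalizers: for almost every
history, with `y = z̃` and `F` the learned prediction, `N (F - h z) - N (F - h z') = μ * (N (y - z)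
- N (y - z'))` for almost all `z, z'`.

The core is the rigidity of this relation, without continuity of `h`
(`dist_eq_of_distance_profiles`). Pass to the closure of the graph of `h`, on which each `y ∈ Z` has
some `F`. Setting `y = z` and using the triangle inequality shows that `h` expands distances by at
least `μ`, so its inverse is Lipschitz on the image `H`. Moreover `h z` is a point of `H` nearest to
`F`. If `h z` is a Lebesgue density point of `H` this forces `F = h z`, and the relation becomes `N
(h z - h z') = μ * N (z - z')`. The other points of `H` form a null set, which the Lipschitz inverse
sends to a null set of states, so the equality holds on a dense set and hence everywhere. A
similarity of a convex body into its own space is affine, by a local Mazur–Ulam argument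
(`exists_linear_of_similarity`).

Once `h z = U z + b`, the profile determines its centre, so `F = U y + b`
(`eq_of_distance_profiles`). Both sides are affine in the history, whose law is absolutely
continuous, so the identity extends to all histories and the matrices can be compared. For `ℓ^p`
norms, `μ⁻¹ • U` preserves Lebesgue measure on the unit ball, whose second-moment matrix is scalar
by symmetry. This gives orthogonality (`mem_orthogonalGroup_of_isometry`). -/

noncomputable section

namespace ContrastiveVAR

/-! ### Similarities of convex sets with non-empty interior are affine. -/

section Lens

variable {E : Type*} [NormedAddCommGroup E] [NormedSpace ℝ E] {N : Seminorm ℝ E}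

/-- The point reflection exchanging `x` and `y`, as a permutation of the lens around them. -/
def lensReflection (N : Seminorm ℝ E) (x y : E) (R : ℝ) :
    Equiv.Perm ↥(N.closedBall x R ∩ N.closedBall y R) :=
  Function.Involutive.toPerm
    (fun p => ⟨x + y - p, by
      obtain ⟨p, hp⟩ := p
      simp only [mem_inter_iff, Seminorm.mem_closedBall] at hp ⊢
      constructor
      · rw [show x + y - p - x = -(p - y) by abel, map_neg_eq_map]; exact hp.2
      · rw [show x + y - p - y = -(p - x) by abel, map_neg_eq_map]; exact hp.1⟩)
    fun p => by ext; simp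

theorem lensReflection_apply (x y : E) (R : ℝ) (p : ↥(N.closedBall x R ∩ N.closedBall y R)) :
    (lensReflection N x y R p : E) = x + y - p := rfl

end Lens

section Similarities

variable {E : Type*} [NormedAddCommGroup E] [NormedSpace ℝ E] [FiniteDimensional ℝ E]
  (N : Seminorm ℝ E)

theorem seminorm_continuous : Continuous N := by
  rw [← continuousOn_univ]
  exact N.convexOn.continuousOn isOpen_univ

theorem exists_seminorm_le : ∃ b : ℝ, 0 < b ∧ ∀ x, N x ≤ b * ‖x‖ :=
  Seminorm.bound_of_continuous_normedSpace N (seminorm_continuous N)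

variable {N}

theorem exists_le_seminorm (hN : ∀ x, N x = 0 → x = 0) :
    ∃ a : ℝ, 0 < a ∧ ∀ x, a * ‖x‖ ≤ N x := by
  rcases subsingleton_or_nontrivial E with hE | hE
  · exact ⟨1, one_pos, fun x => by simp [Subsingleton.elim x 0]⟩
  obtain ⟨u, hu, hmin⟩ := (isCompact_sphere (0 : E) 1).exists_isMinOn
    (NormedSpace.sphere_nonempty.2 zero_le_one) (seminorm_continuous N).continuousOn
  have hu1 : ‖u‖ = 1 := by simpa using hu
  have hupos : 0 < N u := lt_of_le_of_ne (apply_nonneg N u) fun h => by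
    rw [hN u h.symm] at hu1
    simp at hu1
  refine ⟨N u, hupos, fun x => ?_⟩
  rcases eq_or_ne x 0 with rfl | hx
  · simp
  have hx' : 0 < ‖x‖ := norm_pos_iff.2 hx
  have h1 : N u ≤ N (‖x‖⁻¹ • x) := hmin (by simp [norm_smul, hx'.ne'])
  rw [map_smul_eq_mul, norm_inv, norm_norm] at h1
  calc N u * ‖x‖ ≤ (‖x‖⁻¹ * N x) * ‖x‖ := by gcongr
    _ = N x := by field_simp

theorem exists_lipschitzOnWith (hN : ∀ x, N x = 0 → x = 0) {f : E → E} {S : Set E} {c : ℝ}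
    (hc : 0 ≤ c) (hf : ∀ x ∈ S, ∀ y ∈ S, N (f x - f y) ≤ c * N (x - y)) :
    ∃ K, LipschitzOnWith K f S := by
  obtain ⟨a, ha, hle⟩ := exists_le_seminorm hN
  obtain ⟨b, hb, hge⟩ := exists_seminorm_le N
  refine ⟨⟨a⁻¹ * (c * b), by positivity⟩, LipschitzOnWith.of_dist_le_mul fun x hx y hy => ?_⟩
  rw [dist_eq_norm, dist_eq_norm]
  have h : a * ‖f x - f y‖ ≤ c * (b * ‖x - y‖) :=
    (hle _).trans ((hf x hx y hy).trans (by gcongr; exact hge _))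
  change ‖f x - f y‖ ≤ a⁻¹ * (c * b) * ‖x - y‖
  rw [mul_assoc, mul_assoc, inv_mul_eq_div, le_div_iff₀' ha]
  exact h

theorem isCompact_seminorm_closedBall (hN : ∀ x, N x = 0 → x = 0) (x : E) (R : ℝ) :
    IsCompact (N.closedBall x R) := by
  obtain ⟨a, ha, hle⟩ := exists_le_seminorm hN
  have hcl : IsClosed (N.closedBall x R) := by
    have : N.closedBall x R = (fun p => N (p - x)) ⁻¹' Iic R := by
      ext p; simp [Seminorm.mem_closedBall]
    rw [this]
    exact isClosed_Iic.preimage ((seminorm_continuous N).comp (continuous_id.sub continuous_const))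
  refine (isCompact_closedBall x (R / a)).of_isClosed_subset hcl fun p hp => ?_
  rw [mem_closedBall_iff_norm, le_div_iff₀' ha]
  exact (hle _).trans ((N.mem_closedBall).1 hp)

/-- Orbits are recurrent: along a convergent subsequence of the orbit of `p`, consecutive terms get
close, and the isometry carries this back to `φ^[m] p` being close to `p`. So `p` is a limit of
points of the closed set `φ '' K`. -/
theorem surjOn_of_isometric (hN : ∀ x, N x = 0 → x = 0) {K : Set E} (hK : IsCompact K)
    {φ : E → E} (hmaps : MapsTo φ K K)
    (hiso : ∀ x ∈ K, ∀ y ∈ K, N (φ x - φ y) = N (x - y)) : SurjOn φ K K := by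
  intro p hp
  obtain ⟨a, ha, hle⟩ := exists_le_seminorm hN
  obtain ⟨L, hL⟩ := exists_lipschitzOnWith hN (f := φ) (S := K) zero_le_one
    fun x hx y hy => by rw [one_mul]; exact (hiso x hx y hy).le
  have hcl : IsClosed (φ '' K) := (hK.image_of_continuousOn hL.continuousOn).isClosed
  have hmem : ∀ n, φ^[n] p ∈ K := fun n => hmaps.iterate n hp
  have hshift : ∀ m n, N (φ^[m + n] p - φ^[n] p) = N (φ^[m] p - p) := by
    intro m n
    induction n with
    | zero => simp
    | succ n ih =>
      rw [← add_assoc, Function.iterate_succ_apply', Function.iterate_succ_apply',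
        hiso _ (hmem _) _ (hmem _), ih]
  obtain ⟨q, -, s, hs, hlim⟩ := hK.isSeqCompact hmem
  have hdiff : Tendsto (fun n => φ^[s (n + 1) - s n] p - p) atTop (𝓝 0) := by
    have h0 : Tendsto (fun n => φ^[s (n + 1)] p - φ^[s n] p) atTop (𝓝 (q - q)) :=
      (hlim.comp (tendsto_add_atTop_nat 1)).sub hlim
    rw [sub_self] at h0
    have h1 : Tendsto (fun n => a⁻¹ * N (φ^[s (n + 1)] p - φ^[s n] p)) atTop (𝓝 0) := by
      have := (((seminorm_continuous N).tendsto 0).comp h0).const_mul a⁻¹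
      simpa using this
    refine squeeze_zero_norm (fun n => ?_) h1
    have hlt : s n < s (n + 1) := hs (Nat.lt_succ_self n)
    have := hshift (s (n + 1) - s n) (s n)
    rw [Nat.sub_add_cancel hlt.le] at this
    rw [this, inv_mul_eq_div, le_div_iff₀' ha]
    exact hle _
  have hlim' : Tendsto (fun n => φ^[s (n + 1) - s n] p) atTop (𝓝 p) := by
    simpa using hdiff.add_const p
  refine hcl.mem_of_tendsto hlim' (Eventually.of_forall fun n => ?_)
  obtain ⟨k, hk⟩ := Nat.exists_eq_succ_of_ne_zero
    (Nat.sub_ne_zero_of_lt (hs (Nat.lt_succ_self n)))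
  exact ⟨φ^[k] p, hmem k, by rw [hk, Function.iterate_succ_apply']⟩

/-- Väisälä's reflection argument: a bijective isometry of a bounded space that fixes two points
exchanged by a point reflection also fixes the centre of the reflection. -/
theorem perm_fixes_center {X : Type*} (dst : X → X → ℝ) {ψ : Equiv.Perm X}
    (hψ : ∀ p q, dst (ψ p) (ψ q) = dst p q) {x y z : X} (hz : ψ z = z) (hx : ψ x = y)
    (hy : ψ y = x) (hrefl : ∀ p, dst (ψ p) p = 2 * dst p z)
    {C : ℝ} (hC : ∀ p, dst p z ≤ C) (hsep : ∀ p, dst p z ≤ 0 → p = z)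
    {e : Equiv.Perm X} (he : ∀ p q, dst (e p) (e q) = dst p q) (hex : e x = x) (hey : e y = y) :
    e z = z := by
  -- The permutation `ψ ∘ e⁻¹ ∘ ψ ∘ e` again fixes `x` and `y` but displaces `z` twice as far as
  -- `e`. Since `C` bounds all displacements of `z`, repeated doubling forces displacement zero.
  have key : ∀ (n : ℕ) (e : Equiv.Perm X), (∀ p q, dst (e p) (e q) = dst p q) → e x = x →
      e y = y → 2 ^ n * dst (e z) z ≤ C := by
    intro n
    induction n with
    | zero => intro e _ _ _; simpa using hC _
    | succ n ih =>
      intro e he hex hey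
      have he' : ∀ p q, dst (e.symm p) (e.symm q) = dst p q := fun p q => by
        rw [← he, e.apply_symm_apply, e.apply_symm_apply]
      have h := ih (((e.trans ψ).trans e.symm).trans ψ)
        (fun p q => by simp [hψ, he, he'])
        (by simp [hex, hx, e.symm_apply_eq.2 hey.symm, hy])
        (by simp [hey, hx, e.symm_apply_eq.2 hex.symm, hy])
      have h2 : dst ((((e.trans ψ).trans e.symm).trans ψ) z) z = 2 * dst (e z) z := by
        rw [← hrefl, ← he (((e.trans ψ).trans e.symm).trans ψ z)]
        simp only [Equiv.trans_apply]
        conv_lhs => rw [he, ← hz, hψ, ← he, e.apply_symm_apply, hz]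
      rw [h2] at h
      calc 2 ^ (n + 1) * dst (e z) z = 2 ^ n * (2 * dst (e z) z) := by ring
        _ ≤ C := h
  refine hsep _ (le_of_forall_pos_le_add fun ε hε => ?_)
  obtain ⟨n, hn⟩ := pow_unbounded_of_one_lt (C / ε) (one_lt_two (α := ℝ))
  have h1 := key n e he hex hey
  have hpow : (0 : ℝ) < 2 ^ n := by positivity
  rw [div_lt_iff₀ hε] at hn
  have : 2 ^ n * dst (e z) z ≤ 2 ^ n * ε := h1.trans hn.le
  simpa using le_of_mul_le_mul_left this hpow

variable {f : E → E} {Z : Set E} {μ : ℝ}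

/-- Surjectivity is the point: recentred and divided by `μ`, `f` is an isometric self-map of a
compact ball about the origin. -/
theorem bijOn_seminorm_closedBall (hN : ∀ x, N x = 0 → x = 0) (hμ : 0 < μ)
    (hf : ∀ x ∈ Z, ∀ y ∈ Z, N (f x - f y) = μ * N (x - y)) {x : E} (hx : x ∈ Z) {R : ℝ}
    (hball : N.closedBall x R ⊆ Z) :
    BijOn f (N.closedBall x R) (N.closedBall (f x) (μ * R)) := by
  refine ⟨fun p hp => ?_, fun p hp q hq hpq => ?_, fun q hq => ?_⟩
  · rw [Seminorm.mem_closedBall, hf p (hball hp) x hx]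
    exact mul_le_mul_of_nonneg_left (N.mem_closedBall.1 hp) hμ.le
  · have := hf p (hball hp) q (hball hq)
    rw [hpq, sub_self, map_zero, zero_eq_mul] at this
    exact sub_eq_zero.1 (hN _ (this.resolve_left hμ.ne'))
  · have hmem : ∀ v ∈ N.closedBall (0 : E) R, x + v ∈ N.closedBall x R := fun v hv => by
      simpa [Seminorm.mem_closedBall] using hv
    have hsurj : SurjOn (fun v => μ⁻¹ • (f (x + v) - f x)) (N.closedBall 0 R)
        (N.closedBall 0 R) := by
      refine surjOn_of_isometric hN (isCompact_seminorm_closedBall hN _ _) (fun v hv => ?_)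
        fun v hv w hw => ?_
      · rw [Seminorm.mem_closedBall, sub_zero, map_smul_eq_mul,
          hf _ (hball (hmem v hv)) _ hx, Real.norm_eq_abs, abs_of_pos (inv_pos.2 hμ),
          inv_mul_cancel_left₀ hμ.ne']
        simpa [Seminorm.mem_closedBall] using hv
      · rw [← smul_sub, sub_sub_sub_cancel_right, map_smul_eq_mul,
          hf _ (hball (hmem v hv)) _ (hball (hmem w hw)), Real.norm_eq_abs,
          abs_of_pos (inv_pos.2 hμ), inv_mul_cancel_left₀ hμ.ne', add_sub_add_left_eq_sub]
    have hq' : μ⁻¹ • (q - f x) ∈ N.closedBall (0 : E) R := by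
      rw [Seminorm.mem_closedBall, sub_zero, map_smul_eq_mul, Real.norm_eq_abs,
        abs_of_pos (inv_pos.2 hμ), inv_mul_le_iff₀ hμ]
      exact N.mem_closedBall.1 hq
    obtain ⟨v, hv, hvq⟩ := hsurj hq'
    refine ⟨x + v, hmem v hv, ?_⟩
    have := smul_right_injective E (inv_ne_zero hμ.ne') hvq
    simpa using this

end Similarities

section AffineSimilarities

variable {E : Type*} [NormedAddCommGroup E] [NormedSpace ℝ E] [FiniteDimensional ℝ E]
  {N : Seminorm ℝ E} {f : E → E} {Z : Set E} {μ : ℝ}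

/-- With both balls inside `Z`, `f` maps the lens around `x, y` onto the lens around `f x, f y`.
Transporting the reflection of the image lens back by `f` and composing it with the reflection of
the source gives an isometry fixing `x` and `y`. It therefore fixes the midpoint, so `f` of the
midpoint is the centre of the image reflection. -/
theorem map_midpoint_of_lens_subset (hN : ∀ x, N x = 0 → x = 0) (hμ : 0 < μ)
    (hf : ∀ x ∈ Z, ∀ y ∈ Z, N (f x - f y) = μ * N (x - y)) {x y : E}
    (hx : N.closedBall x (N (x - y)) ⊆ Z) (hy : N.closedBall y (N (x - y)) ⊆ Z) :
    f ((1 / 2 : ℝ) • (x + y)) = (1 / 2 : ℝ) • (f x + f y) := by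
  set R := N (x - y) with hR
  have hR0 : 0 ≤ R := apply_nonneg N _
  have hxZ : x ∈ Z := hx (by simpa [Seminorm.mem_closedBall] using hR0)
  have hyZ : y ∈ Z := hy (by simpa [Seminorm.mem_closedBall] using hR0)
  have hbx := bijOn_seminorm_closedBall hN hμ hf hxZ hx
  have hby := bijOn_seminorm_closedBall hN hμ hf hyZ hy
  have hbij : BijOn f (N.closedBall x R ∩ N.closedBall y R)
      (N.closedBall (f x) (μ * R) ∩ N.closedBall (f y) (μ * R)) := by
    refine ⟨fun p hp => ⟨hbx.mapsTo hp.1, hby.mapsTo hp.2⟩, hbx.injOn.mono inter_subset_left,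
      fun q hq => ?_⟩
    obtain ⟨p, hp, rfl⟩ := hbx.surjOn hq.1
    refine ⟨p, ⟨hp, ?_⟩, rfl⟩
    have := N.mem_closedBall.1 hq.2
    rw [hf p (hx hp) y hyZ] at this
    exact N.mem_closedBall.2 (le_of_mul_le_mul_left this hμ)
  have hxW : x ∈ N.closedBall x R ∩ N.closedBall y R :=
    ⟨by simpa [Seminorm.mem_closedBall] using hR0, by simp [Seminorm.mem_closedBall, hR]⟩
  have hyW : y ∈ N.closedBall x R ∩ N.closedBall y R :=
    ⟨by simp [Seminorm.mem_closedBall, hR, map_sub_rev],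
      by simpa [Seminorm.mem_closedBall] using hR0⟩
  have hmx : (1 / 2 : ℝ) • (x + y) - x = (1 / 2 : ℝ) • (y - x) := by module
  have hmy : (1 / 2 : ℝ) • (x + y) - y = (1 / 2 : ℝ) • (x - y) := by module
  have hmW : (1 / 2 : ℝ) • (x + y) ∈ N.closedBall x R ∩ N.closedBall y R := by
    constructor
    · rw [Seminorm.mem_closedBall, hmx, map_smul_eq_mul, map_sub_rev, ← hR]
      norm_num; linarith
    · rw [Seminorm.mem_closedBall, hmy, map_smul_eq_mul, ← hR]
      norm_num; linarith
  set e := hbij.equiv f with he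
  have heq : ∀ p, (e p : E) = f p := fun p => rfl
  have hesymm : ∀ p q, N (e.symm p - e.symm q : E) = μ⁻¹ * N (p - q : E) := fun p q => by
    obtain ⟨p, rfl⟩ := e.surjective p
    obtain ⟨q, rfl⟩ := e.surjective q
    rw [e.symm_apply_apply, e.symm_apply_apply, heq, heq, hf _ (hx p.2.1) _ (hx q.2.1),
      inv_mul_cancel_left₀ hμ.ne']
  set ψ := lensReflection N x y R
  set ψ' := lensReflection N (f x) (f y) (μ * R)
  have hfix := perm_fixes_center
    (fun p q : ↥(N.closedBall x R ∩ N.closedBall y R) => N (p - q : E)) (ψ := ψ) (x := ⟨x, hxW⟩) (y := ⟨y, hyW⟩)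
    (z := ⟨_, hmW⟩) (C := 2 * R) (e := ((e.trans ψ').trans e.symm).trans ψ)
    (fun p q => by
      simp only [ψ, lensReflection_apply]
      rw [sub_sub_sub_cancel_left, map_sub_rev])
    (by ext; simp only [ψ, lensReflection_apply]; module)
    (by ext; simp [ψ, lensReflection_apply])
    (by ext; simp [ψ, lensReflection_apply])
    (fun p => by
      simp only [ψ, lensReflection_apply]
      rw [show x + y - (p : E) - p = (-2 : ℝ) • ((p : E) - (1 / 2 : ℝ) • (x + y)) by module,
        map_smul_eq_mul]
      norm_num)
    (fun p => by
      have h1 := N.mem_closedBall.1 p.2.1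
      have h2 := N.mem_closedBall.1 hmW.1
      calc N ((p : E) - (1 / 2 : ℝ) • (x + y))
          = N (((p : E) - x) - ((1 / 2 : ℝ) • (x + y) - x)) := by congr 1; abel
        _ ≤ N ((p : E) - x) + N ((1 / 2 : ℝ) • (x + y) - x) := map_sub_le_add N _ _
        _ ≤ 2 * R := by linarith)
    (fun p hp => by
      ext
      exact sub_eq_zero.1 (hN _ (le_antisymm hp (apply_nonneg N _))))
    (fun p q => by
      simp only [Equiv.trans_apply, ψ, ψ', lensReflection_apply]
      rw [sub_sub_sub_cancel_left, map_sub_rev, hesymm, lensReflection_apply,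
        lensReflection_apply, sub_sub_sub_cancel_left, map_sub_rev, heq, heq,
        hf _ (hx p.2.1) _ (hx q.2.1), inv_mul_cancel_left₀ hμ.ne'])
    (by
      have h : ψ' (e ⟨x, hxW⟩) = e ⟨y, hyW⟩ := by
        ext; simp [ψ', lensReflection_apply, heq]
      ext
      simp [h, ψ, lensReflection_apply])
    (by
      have h : ψ' (e ⟨y, hyW⟩) = e ⟨x, hxW⟩ := by
        ext; simp [ψ', lensReflection_apply, heq]
      ext
      simp [h, ψ, lensReflection_apply])
  simp only [Equiv.trans_apply] at hfix
  have hfix2 : e.symm (ψ' (e ⟨_, hmW⟩)) = ⟨_, hmW⟩ := by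
    have h := congrArg (Subtype.val) hfix
    simp only [ψ, lensReflection_apply] at h
    ext
    have h3 := eq_sub_of_add_eq' ((sub_eq_iff_eq_add.1 h).symm)
    rw [h3]
    module
  rw [Equiv.symm_apply_eq] at hfix2
  have h := congrArg Subtype.val hfix2
  simp only [ψ', lensReflection_apply, heq] at h
  rw [sub_eq_iff_eq_add, ← two_smul ℝ] at h
  rw [h, smul_smul]
  norm_num

/-- The lens argument covers only points at distance at most `ε`; each induction step doubles the
admissible distance. With `m` the midpoint, `m` is also the midpoint of the quarter points, and the
three half-distance relations yield `f m = (1/4) • (f x + f y) + (1/2) • f m`. -/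
theorem map_midpoint_of_closedBall_subset (hN : ∀ x, N x = 0 → x = 0) (hμ : 0 < μ)
    (hZ : Convex ℝ Z) (hf : ∀ x ∈ Z, ∀ y ∈ Z, N (f x - f y) = μ * N (x - y)) {ε : ℝ} (hε : 0 < ε)
    {x y : E} (hx : N.closedBall x ε ⊆ Z) (hy : N.closedBall y ε ⊆ Z) :
    f ((1 / 2 : ℝ) • (x + y)) = (1 / 2 : ℝ) • (f x + f y) := by
  have hmid : ∀ u v, N.closedBall u ε ⊆ Z → N.closedBall v ε ⊆ Z →
      N.closedBall ((1 / 2 : ℝ) • (u + v)) ε ⊆ Z := by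
    intro u v hu hv p hp
    rw [Seminorm.mem_closedBall] at hp
    have h1 : u + (p - (1 / 2 : ℝ) • (u + v)) ∈ Z := hu (by
      rw [Seminorm.mem_closedBall, add_sub_cancel_left]; exact hp)
    have h2 : v + (p - (1 / 2 : ℝ) • (u + v)) ∈ Z := hv (by
      rw [Seminorm.mem_closedBall, add_sub_cancel_left]; exact hp)
    have := hZ h1 h2 (a := 1 / 2) (b := 1 / 2) (by norm_num) (by norm_num) (by norm_num)
    convert this using 1
    module
  have key : ∀ n : ℕ, ∀ x y, N.closedBall x ε ⊆ Z → N.closedBall y ε ⊆ Z →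
      N (x - y) ≤ 2 ^ n * ε → f ((1 / 2 : ℝ) • (x + y)) = (1 / 2 : ℝ) • (f x + f y) := by
    intro n
    induction n with
    | zero =>
      intro x y hx hy hxy
      rw [pow_zero, one_mul] at hxy
      exact map_midpoint_of_lens_subset hN hμ hf ((N.closedBall_mono hxy).trans hx)
        ((N.closedBall_mono hxy).trans hy)
    | succ n ih =>
      intro x y hx hy hxy
      have hxy' : (1 / 2 : ℝ) * N (x - y) ≤ 2 ^ n * ε := by rw [pow_succ] at hxy; linarith
      have hhalf : ∀ u v : E, u - v = (1 / 2 : ℝ) • (x - y) → N (u - v) ≤ 2 ^ n * ε := by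
        intro u v h
        rw [h, map_smul_eq_mul]
        convert hxy' using 2
        norm_num
      set m := (1 / 2 : ℝ) • (x + y) with hm
      have hmZ := hmid x y hx hy
      have h1 := ih x m hx hmZ (hhalf _ _ (by rw [hm]; module))
      have h2 := ih m y hmZ hy (hhalf _ _ (by rw [hm]; module))
      have h3 := ih ((1 / 2 : ℝ) • (x + m)) ((1 / 2 : ℝ) • (m + y)) (hmid x m hx hmZ)
        (hmid m y hmZ hy) (hhalf _ _ (by rw [hm]; module))
      rw [h1, h2, show (1 / 2 : ℝ) • ((1 / 2 : ℝ) • (x + m) + (1 / 2 : ℝ) • (m + y)) = m by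
        rw [hm]; module] at h3
      have h4 : (1 / 2 : ℝ) • f m = (1 / 4 : ℝ) • (f x + f y) := by
        have h5 : f m - (1 / 2 : ℝ) • f m = (1 / 4 : ℝ) • (f x + f y) := by
          nth_rewrite 1 [h3]; module
        rw [← h5]; module
      calc f m = (2 : ℝ) • (1 / 2 : ℝ) • f m := by module
        _ = (1 / 2 : ℝ) • (f x + f y) := by rw [h4]; module
  obtain ⟨n, hn⟩ := pow_unbounded_of_one_lt (N (x - y) / ε) (one_lt_two (α := ℝ))
  exact key n x y hx hy ((div_lt_iff₀ hε).1 hn).le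

theorem exists_seminorm_closedBall_subset {s : Set E} {c : E} (hN : ∀ x, N x = 0 → x = 0)
    (hc : c ∈ interior s) : ∃ ε : ℝ, 0 < ε ∧ N.closedBall c ε ⊆ s := by
  obtain ⟨a, ha, hle⟩ := exists_le_seminorm hN
  obtain ⟨r, hr, hball⟩ := Metric.mem_nhds_iff.1 (mem_interior_iff_mem_nhds.1 hc)
  refine ⟨a * r / 2, by positivity, fun p hp => hball ?_⟩
  rw [Metric.mem_ball, dist_eq_norm]
  have h := (hle (p - c)).trans (N.mem_closedBall.1 hp)
  have : ‖p - c‖ ≤ r / 2 := le_of_mul_le_mul_left (by linarith) ha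
  linarith

/-- Boundary points are reached by contracting towards an interior point `c`: by convexity, moving
the fraction `t` towards `c` gives a point with a ball of radius `t * ε` inside `Z`. -/
theorem map_midpoint_of_similarity (hN : ∀ x, N x = 0 → x = 0) (hμ : 0 < μ)
    (hZ : Convex ℝ Z) (hZint : (interior Z).Nonempty)
    (hf : ∀ x ∈ Z, ∀ y ∈ Z, N (f x - f y) = μ * N (x - y)) {x y : E} (hx : x ∈ Z) (hy : y ∈ Z) :
    f ((1 / 2 : ℝ) • (x + y)) = (1 / 2 : ℝ) • (f x + f y) := by
  obtain ⟨c, hc⟩ := hZint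
  have hcZ := interior_subset hc
  obtain ⟨ε, hε, hball⟩ := exists_seminorm_closedBall_subset hN hc
  obtain ⟨L, hL⟩ := exists_lipschitzOnWith hN hμ.le fun x hx y hy => (hf x hx y hy).le
  set t : ℕ → ℝ := fun n => 1 / ((n : ℝ) + 1)
  have ht0 : ∀ n, 0 < t n := fun n => by positivity
  have ht1 : ∀ n, t n ≤ 1 := fun n => by
    simp only [t]
    rw [div_le_one (by positivity)]
    have : (0 : ℝ) ≤ n := by positivity
    linarith
  have hseg : ∀ u ∈ Z, ∀ n, u + t n • (c - u) ∈ Z := fun u hu n =>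
    hZ.add_smul_sub_mem hu hcZ ⟨(ht0 n).le, ht1 n⟩
  have hlim : ∀ u ∈ Z, Tendsto (fun n => f (u + t n • (c - u))) atTop (𝓝 (f u)) := by
    intro u hu
    refine (hL.continuousOn u hu).tendsto.comp (tendsto_nhdsWithin_iff.2
      ⟨?_, Eventually.of_forall (hseg u hu)⟩)
    have := (tendsto_one_div_add_atTop_nhds_zero_nat (𝕜 := ℝ)).smul_const (c - u)
    simpa [t] using this.const_add u
  have hin : ∀ u ∈ Z, ∀ n, N.closedBall (u + t n • (c - u)) (t n * ε) ⊆ Z := by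
    intro u hu n p hp
    have hq : c + (t n)⁻¹ • (p - (u + t n • (c - u))) ∈ Z := hball (by
      rw [Seminorm.mem_closedBall, add_sub_cancel_left, map_smul_eq_mul, Real.norm_eq_abs,
        abs_of_pos (inv_pos.2 (ht0 n)), inv_mul_le_iff₀ (ht0 n)]
      exact N.mem_closedBall.1 hp)
    convert hZ.add_smul_sub_mem hu hq ⟨(ht0 n).le, ht1 n⟩ using 1
    rw [show t n • (c + (t n)⁻¹ • (p - (u + t n • (c - u))) - u) =
      t n • (c - u) + (t n * (t n)⁻¹) • (p - (u + t n • (c - u))) by module,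
      mul_inv_cancel₀ (ht0 n).ne']
    module
  have hm : (1 / 2 : ℝ) • (x + y) ∈ Z := by
    have := hZ hx hy (a := 1 / 2) (b := 1 / 2) (by norm_num) (by norm_num) (by norm_num)
    rwa [smul_add]
  refine tendsto_nhds_unique (hlim _ hm) ?_
  refine (((hlim x hx).add (hlim y hy)).const_smul (1 / 2 : ℝ)).congr fun n => ?_
  rw [← map_midpoint_of_closedBall_subset hN hμ hZ hf (mul_pos (ht0 n) hε) (hin x hx n)
    (hin y hy n)]
  congr 1
  module

/-- A similarity from a convex set with non-empty interior into a finite-dimensional normed space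
of the same dimension is affine. -/
theorem exists_linear_of_similarity (hN : ∀ x, N x = 0 → x = 0) (hμ : 0 < μ)
    (hZ : Convex ℝ Z) (hZint : (interior Z).Nonempty)
    (hf : ∀ x ∈ Z, ∀ y ∈ Z, N (f x - f y) = μ * N (x - y)) :
    ∃ (U : E →ₗ[ℝ] E) (b : E), (∀ x, N (U x) = μ * N x) ∧ ∀ z ∈ Z, f z = U z + b := by
  have hmid := fun x hx y hy => map_midpoint_of_similarity hN hμ hZ hZint hf (x := x) (y := y) hx hy
  obtain ⟨c, hc⟩ := hZint
  have hcZ := interior_subset hc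
  set φ : E → E := fun v => f (c + v) - f c with hφ
  set t : ℝ := 1 / 2
  have hshrink : ∀ v, c + v ∈ Z → ∀ k : ℕ, c + t ^ k • v ∈ Z := fun v hv k => by
    have := hZ.add_smul_sub_mem hcZ hv (t := t ^ k)
      ⟨by positivity, pow_le_one₀ (by norm_num [t]) (by norm_num [t])⟩
    simpa using this
  have hhalf : ∀ v w, c + v ∈ Z → c + w ∈ Z → φ (t • (v + w)) = t • (φ v + φ w) := by
    intro v w hv hw
    have h := hmid _ hv _ hw
    simp only [hφ]
    rw [show c + t • (v + w) = (1 / 2 : ℝ) • (c + v + (c + w)) by simp only [t]; module, h]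
    module
  have hpow : ∀ v, c + v ∈ Z → ∀ k : ℕ, φ (t ^ k • v) = t ^ k • φ v := by
    intro v hv k
    induction k with
    | zero => simp
    | succ k ih =>
      have h := hhalf (t ^ k • v) 0 (hshrink v hv k) (by simpa using hcZ)
      have h0 : φ 0 = 0 := by simp [hφ]
      rw [add_zero, h0, add_zero, ih, smul_smul, smul_smul] at h
      rw [pow_succ', h]
  have hsmall : ∀ v : E, ∃ n : ℕ, c + t ^ n • v ∈ Z := by
    intro v
    have hlim : Tendsto (fun n : ℕ => c + t ^ n • v) atTop (𝓝 c) := by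
      have := (tendsto_pow_atTop_nhds_zero_of_lt_one (r := t) (by norm_num [t])
        (by norm_num [t])).smul_const v
      simpa using this.const_add c
    exact (hlim.eventually (mem_interior_iff_mem_nhds.1 hc)).exists
  choose n hn using hsmall
  -- `φ` is only controlled near the origin, so its linear extension is defined by shrinking `v`
  -- into the domain and rescaling. `hVeq` shows that the exponent does not matter once it is large
  -- enough.
  set V : E → E := fun v => (t ^ n v)⁻¹ • φ (t ^ n v • v) with hV
  have htpos : ∀ k : ℕ, t ^ k ≠ 0 := fun k => by positivity
  have hVeq : ∀ v m, n v ≤ m → φ (t ^ m • v) = t ^ m • V v := by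
    intro v m hm
    obtain ⟨k, rfl⟩ := Nat.exists_eq_add_of_le' hm
    have h := hpow _ (hn v) k
    rw [smul_smul, ← pow_add] at h
    rw [h, hV, smul_smul, pow_add, mul_assoc, mul_inv_cancel₀ (htpos _), mul_one]
  have hmem : ∀ v m, n v ≤ m → c + t ^ m • v ∈ Z := by
    intro v m hm
    obtain ⟨k, rfl⟩ := Nat.exists_eq_add_of_le' hm
    have h := hshrink _ (hn v) k
    rwa [smul_smul, ← pow_add] at h
  have hadd : ∀ v w, V (v + w) = V v + V w := by
    intro v w
    set m := max (max (n v) (n w)) (n (v + w))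
    have h1 : n v ≤ m := (le_max_left _ _).trans (le_max_left _ _)
    have h2 : n w ≤ m := (le_max_right _ _).trans (le_max_left _ _)
    have h3 : n (v + w) ≤ m + 1 := (le_max_right _ _).trans (Nat.le_succ m)
    have h := hhalf _ _ (hmem v m h1) (hmem w m h2)
    rw [hVeq v m h1, hVeq w m h2, ← smul_add, ← smul_add, smul_smul t (t ^ m),
      smul_smul t (t ^ m), ← pow_succ', hVeq _ _ h3] at h
    exact smul_right_injective E (htpos _) h
  have hiso : ∀ v, N (V v) = μ * N v := by
    intro v
    have htp : (0 : ℝ) < t ^ n v := by positivity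
    simp only [hV, hφ]
    rw [map_smul_eq_mul, hf _ (hn v) _ hcZ, add_sub_cancel_left, map_smul_eq_mul, norm_inv,
      Real.norm_eq_abs, abs_of_pos htp]
    field_simp
  have hcont : Continuous V := by
    rw [← continuousOn_univ]
    obtain ⟨K, hK⟩ := exists_lipschitzOnWith hN (f := V) (S := univ) hμ.le fun x _ y _ => by
      rw [← hiso, sub_eq_iff_eq_add.2 (by rw [← hadd, sub_add_cancel] : V x = V (x - y) + V y)]
    exact hK.continuousOn
  refine ⟨((AddMonoidHom.mk' V hadd).toRealLinearMap hcont).toLinearMap, f c - V c, hiso,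
    fun z hz => ?_⟩
  have h := hpow (z - c) (by simpa using hz) (n (z - c))
  rw [hVeq _ _ le_rfl] at h
  have h' := smul_right_injective E (htpos _) h
  have h2 : V z = V (z - c) + V c := by rw [← hadd, sub_add_cancel]
  change f z = V z + (f c - V c)
  rw [h2, h']
  simp only [hφ, add_sub_cancel]
  abel

end AffineSimilarities

/-! ### Rigidity: matching distance profiles forces an affine similarity. -/

section Rigidity

/-- A full-measure set is dense in the interior, and a convex set with non-empty interior lies in
the closure of its interior. -/
theorem subset_closure_of_ae_restrict {E : Type*} [NormedAddCommGroup E] [NormedSpace ℝ E]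
    {Z : Set E} [MeasurableSpace E] [BorelSpace E] (m : Measure E)
    [m.IsAddHaarMeasure] (hZ : Convex ℝ Z) (hZint : (interior Z).Nonempty) {S : Set E}
    (hS : ∀ᵐ z ∂m.restrict Z, z ∈ S) : Z ⊆ closure (S ∩ Z) := by
  have hS' : ∀ᵐ z ∂m, z ∈ interior Z → z ∈ S :=
    (ae_restrict_iff' isOpen_interior.measurableSet).1
      (ae_restrict_of_ae_restrict_of_subset interior_subset hS)
  have hdense : Dense {z | z ∈ interior Z → z ∈ S} := m.dense_of_ae hS'
  calc Z ⊆ closure Z := subset_closure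
    _ = closure (interior Z) := (hZ.closure_interior_eq_closure_of_nonempty_interior hZint).symm
    _ ⊆ closure (interior Z ∩ {z | z ∈ interior Z → z ∈ S}) :=
      closure_minimal (hdense.open_subset_closure_inter isOpen_interior) isClosed_closure
    _ ⊆ closure (S ∩ Z) := closure_mono fun z hz => ⟨hz.2 hz.1, interior_subset hz.1⟩

variable {E : Type*} [NormedAddCommGroup E] [NormedSpace ℝ E] [FiniteDimensional ℝ E]
  {N : Seminorm ℝ E} {Z : Set E} {μ : ℝ}

/-- A point of a set that has an open ball of the complement touching it is not a point of
Lebesgue density. -/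
theorem eq_of_tendsto_density [MeasurableSpace E] [BorelSpace E] (m : Measure E)
    [m.IsAddHaarMeasure] (hN : ∀ x, N x = 0 → x = 0) {H : Set E} {p F : E}
    (hmin : ∀ q ∈ H, N (F - p) ≤ N (F - q))
    (hdens : Tendsto (fun r => m (H ∩ Metric.closedBall p r) / m (Metric.closedBall p r))
      (𝓝[>] 0) (𝓝 1)) : p = F := by
  by_contra hne
  obtain ⟨a, ha, hle⟩ := exists_le_seminorm hN
  obtain ⟨b, hb, hge⟩ := exists_seminorm_le N
  set n := ‖F - p‖
  have hn : 0 < n := norm_pos_iff.2 (sub_ne_zero.2 (Ne.symm hne))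
  -- The bound `1 / 2` keeps the ball of radius `κ * r` inside `closedBall p r`; the bound `a / (4 *
  -- b)` makes all its points strictly closer to `F` than `p`, hence outside `H`. This ball takes
  -- the fixed proportion `κ ^ finrank` of the volume, so the density of `H` at `p` cannot be `1`.
  set κ := min (1 / 2) (a / (4 * b))
  have hκ : 0 < κ := lt_min (by norm_num) (by positivity)
  have hκ1 : κ ≤ 1 / 2 := min_le_left _ _
  have hκ2 : b * κ ≤ a / 4 := by
    calc b * κ ≤ b * (a / (4 * b)) := by gcongr; exact min_le_right _ _
      _ = a / 4 := by field_simp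
  have hev : ∀ᶠ r in 𝓝[>] (0 : ℝ),
      m (H ∩ Metric.closedBall p r) / m (Metric.closedBall p r)
        + ENNReal.ofReal (κ ^ Module.finrank ℝ E) ≤ 1 := by
    filter_upwards [Ioo_mem_nhdsGT hn] with r hr
    obtain ⟨hr0, hrn⟩ := hr
    -- This places the centre `p + s • (F - p)` at distance `r / 2` from `p`.
    set s := r / (2 * n) with hs
    have hs0 : 0 < s := by positivity
    have hsn : s * n = r / 2 := by rw [hs]; field_simp
    have hs1 : s ≤ 1 := by rw [hs, div_le_one (by positivity)]; linarith
    have hsub : Metric.closedBall (p + s • (F - p)) (κ * r) ⊆ Metric.closedBall p r := by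
      refine Metric.closedBall_subset_closedBall' ?_
      rw [dist_eq_norm, add_sub_cancel_left, norm_smul, Real.norm_eq_abs, abs_of_pos hs0]
      change κ * r + s * n ≤ r
      rw [hsn]
      nlinarith
    have hdisj : Disjoint (H ∩ Metric.closedBall p r)
        (Metric.closedBall (p + s • (F - p)) (κ * r)) := by
      rw [Set.disjoint_left]
      rintro x ⟨hxH, -⟩ hx
      rw [Metric.mem_closedBall, dist_eq_norm] at hx
      have h1 := hmin x hxH
      have h2 : N (F - x) ≤ (1 - s) * N (F - p) + b * (κ * r) := by
        calc N (F - x) = N ((1 - s) • (F - p) - (x - (p + s • (F - p)))) := by congr 1; module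
          _ ≤ N ((1 - s) • (F - p)) + N (x - (p + s • (F - p))) := map_sub_le_add N _ _
          _ ≤ (1 - s) * N (F - p) + b * (κ * r) := by
            rw [map_smul_eq_mul, Real.norm_eq_abs, abs_of_nonneg (by linarith)]
            gcongr
            exact (hge _).trans (by gcongr)
      have h3 : a * (s * n) ≤ s * N (F - p) := by
        rw [mul_left_comm]
        exact mul_le_mul_of_nonneg_left (hle _) hs0.le
      rw [hsn] at h3
      nlinarith
    have hball0 : m (Metric.closedBall p r) ≠ 0 :=
      (Metric.measure_closedBall_pos m p hr0).ne'
    have hballt : m (Metric.closedBall p r) ≠ ⊤ := measure_closedBall_lt_top.ne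
    have hscale : m (Metric.closedBall (p + s • (F - p)) (κ * r)) =
        ENNReal.ofReal (κ ^ Module.finrank ℝ E) * m (Metric.closedBall p r) := by
      rw [Measure.addHaar_closedBall m _ (by positivity), Measure.addHaar_closedBall m p hr0.le,
        mul_pow, ENNReal.ofReal_mul (by positivity), mul_assoc]
    have hle1 : m (H ∩ Metric.closedBall p r) +
        ENNReal.ofReal (κ ^ Module.finrank ℝ E) * m (Metric.closedBall p r) ≤
        m (Metric.closedBall p r) := by
      rw [← hscale, ← measure_union hdisj Metric.isClosed_closedBall.measurableSet]
      exact measure_mono (union_subset inter_subset_right hsub)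
    calc _ = (m (H ∩ Metric.closedBall p r) + ENNReal.ofReal (κ ^ Module.finrank ℝ E) *
          m (Metric.closedBall p r)) / m (Metric.closedBall p r) := by
          rw [ENNReal.add_div, ENNReal.mul_div_cancel_right hball0 hballt]
      _ ≤ 1 := ENNReal.div_le_of_le_mul (by rwa [one_mul])
  have h1 : 1 + ENNReal.ofReal (κ ^ Module.finrank ℝ E) ≤ 1 :=
    le_of_tendsto (hdens.add_const _) hev
  have h2 : (1 : ℝ≥0∞) < 1 + ENNReal.ofReal (κ ^ Module.finrank ℝ E) :=
    ENNReal.lt_add_right ENNReal.one_ne_top (by positivity)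
  exact absurd h1 (not_le.2 h2)

/-- A compact relation between two subsets of a finite-dimensional normed space in which the
distance profiles of the second coordinates are realised, up to additive constants, as distance
profiles of the first coordinates, scales all distances by `μ`. -/
theorem dist_eq_of_distance_profiles (hN : ∀ x, N x = 0 → x = 0) (hμ : 0 < μ)
    (hZconv : Convex ℝ Z) (hZint : (interior Z).Nonempty) {Γ : Set (E × E)} (hΓ : IsCompact Γ)
    (hΓZ : ∀ z ∈ Z, ∃ p, (p, z) ∈ Γ) (hΓZ' : ∀ q ∈ Γ, q.2 ∈ Z)
    (hprof : ∀ y ∈ Z, ∃ F, ∀ q ∈ Γ, ∀ q' ∈ Γ,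
      N (F - q.1) - N (F - q'.1) = μ * (N (y - q.2) - N (y - q'.2))) :
    ∀ q ∈ Γ, ∀ q' ∈ Γ, N (q.1 - q'.1) = μ * N (q.2 - q'.2) := by
  borelize E
  -- In this dimension the Hausdorff measure is a Haar measure, and Lipschitz maps send its null
  -- sets to null sets.
  set m : Measure E := μH[Module.finrank ℝ E]
  have hexp : ∀ q ∈ Γ, ∀ q' ∈ Γ, μ * N (q.2 - q'.2) ≤ N (q.1 - q'.1) := by
    intro q hq q' hq'
    obtain ⟨F, hF⟩ := hprof q.2 (hΓZ' q hq)
    have h1 := hF q hq q' hq'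
    rw [sub_self, map_zero] at h1
    have h3 : N (F - q'.1) ≤ N (F - q.1) + N (q.1 - q'.1) := by
      calc N (F - q'.1) = N ((F - q.1) + (q.1 - q'.1)) := by congr 1; abel
        _ ≤ _ := map_add_le_add N _ _
    linarith
  set H := Prod.fst '' Γ
  have hH : IsCompact H := hΓ.image continuous_fst
  -- Expansion makes the second coordinate a Lipschitz function `k` of the first; the value `0` off
  -- `H` is a dummy.
  have hex : ∀ p, ∃ z, p ∈ H → (p, z) ∈ Γ := fun p => by
    by_cases hp : p ∈ H
    · obtain ⟨⟨p, z⟩, hq, rfl⟩ := hp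
      exact ⟨z, fun _ => hq⟩
    · exact ⟨0, fun h => absurd h hp⟩
  choose k hk using hex
  have hk_eq : ∀ q ∈ Γ, k q.1 = q.2 := by
    intro q hq
    have h := hexp (q.1, k q.1) (hk q.1 ⟨q, hq, rfl⟩) q hq
    simp only [sub_self, map_zero] at h
    have h0 : N (k q.1 - q.2) ≤ 0 := by
      by_contra hcon
      exact absurd h (not_le.2 (mul_pos hμ (not_le.1 hcon)))
    exact sub_eq_zero.1 (hN _ (le_antisymm h0 (apply_nonneg N _)))
  obtain ⟨L, hL⟩ := exists_lipschitzOnWith hN (f := k) (S := H) (c := μ⁻¹) (by positivity)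
    fun x hx y hy => by
      rw [inv_mul_eq_div, le_div_iff₀' hμ]
      exact hexp (x, k x) (hk x hx) (y, k y) (hk y hy)
  set B := {p ∈ H | ¬ Tendsto (fun r => m (H ∩ Metric.closedBall p r) / m (Metric.closedBall p r))
      (𝓝[>] 0) (𝓝 1)}
  have hB : m B = 0 := by
    have h := (ae_restrict_iff' hH.isClosed.measurableSet).1
      (Besicovitch.ae_tendsto_measure_inter_div m H)
    rw [ae_iff] at h
    convert h using 2
    ext p
    simp [B]
  have hkB : m (k '' B) = 0 := by
    refine le_antisymm ?_ zero_le
    refine ((hL.mono (sep_subset _ _)).hausdorffMeasure_image_le (by positivity)).trans ?_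
    change _ * m B ≤ 0
    rw [hB, mul_zero]
  -- The profile of `z` itself makes `p` a nearest point of `H` to `F`; at a density point this
  -- gives `F = p`.
  have hgood : ∀ z, z ∉ k '' B → ∀ p, (p, z) ∈ Γ → ∀ q ∈ Γ, N (p - q.1) = μ * N (z - q.2) := by
    intro z hz p hp q hq
    have hpH : p ∈ H := ⟨_, hp, rfl⟩
    obtain ⟨F, hF⟩ := hprof z (hΓZ' _ hp)
    have hpF : p = F := by
      refine eq_of_tendsto_density m hN (H := H) ?_ ?_
      · rintro _ ⟨q', hq', rfl⟩
        have h := hF _ hp q' hq'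
        simp only [sub_self, map_zero] at h
        have := mul_nonneg hμ.le (apply_nonneg N (z - q'.2))
        linarith
      · by_contra hcon
        exact hz ⟨p, ⟨hpH, hcon⟩, hk_eq _ hp⟩
    subst hpF
    have h := hF _ hp q hq
    simp only [sub_self, map_zero] at h
    linarith
  have hdense : Z ⊆ closure ((k '' B)ᶜ ∩ Z) :=
    subset_closure_of_ae_restrict m hZconv hZint
      (ae_restrict_of_ae (measure_eq_zero_iff_ae_notMem.1 hkB))
  intro q hq q' hq'
  obtain ⟨x, hx, hlim⟩ := mem_closure_iff_seq_limit.1 (hdense (hΓZ' q hq))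
  choose p hp using fun n => hΓZ (x n) (hx n).2
  have hNc := seminorm_continuous N
  have hplim : Tendsto p atTop (𝓝 q.1) := by
    obtain ⟨a, ha, hle⟩ := exists_le_seminorm hN
    have h0 : Tendsto (fun n => a⁻¹ * (μ * N (x n - q.2))) atTop (𝓝 0) := by
      have := ((hNc.tendsto _).comp (hlim.sub_const q.2)).const_mul μ |>.const_mul a⁻¹
      simpa using this
    have h1 : Tendsto (fun n => p n - q.1) atTop (𝓝 0) := by
      refine squeeze_zero_norm (fun n => ?_) h0
      rw [inv_mul_eq_div, le_div_iff₀' ha, ← hgood _ (hx n).1 _ (hp n) q hq]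
      exact hle _
    simpa using h1.add_const q.1
  refine tendsto_nhds_unique ((hNc.tendsto _).comp (hplim.sub_const q'.1)) ?_
  refine (((hNc.tendsto _).comp (hlim.sub_const q'.2)).const_mul μ).congr fun n => ?_
  exact (hgood _ (hx n).1 _ (hp n) q' hq').symm

/-- If the distance profiles of points `y` dense in a convex body are realised, up to additive
constants and the factor `μ`, along the values of `h`, then `h` is affine. -/
theorem exists_linear_of_distance_profiles (hN : ∀ x, N x = 0 → x = 0) (hμ : 0 < μ)
    (hZconv : Convex ℝ Z) (hZcomp : IsCompact Z) (hZint : (interior Z).Nonempty)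
    {h : E → E} {S Y K : Set E} (hSZ : S ⊆ Z) (hS : Z ⊆ closure S) (hh : ∀ z ∈ S, h z ∈ Z)
    (hYZ : Y ⊆ Z) (hY : Z ⊆ closure Y) (hK : IsCompact K)
    (hprof : ∀ y ∈ Y, ∃ F ∈ K, ∀ z ∈ S, ∀ z' ∈ S,
      N (F - h z) - N (F - h z') = μ * (N (y - z) - N (y - z'))) :
    ∃ (U : E →ₗ[ℝ] E) (b : E), (∀ x, N (U x) = μ * N x) ∧ MapsTo (fun z => U z + b) Z Z ∧
      ∀ z ∈ S, h z = U z + b := by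
  have hNc := seminorm_continuous N
  set Γ := closure ((fun z => (h z, z)) '' S)
  have hΓsub : Γ ⊆ Z ×ˢ Z := by
    refine closure_minimal ?_ (hZcomp.isClosed.prod hZcomp.isClosed)
    rintro _ ⟨z, hz, rfl⟩
    exact ⟨hh z hz, hSZ hz⟩
  have hΓ : IsCompact Γ := (hZcomp.prod hZcomp).of_isClosed_subset isClosed_closure hΓsub
  have hSΓ : ∀ z ∈ S, (h z, z) ∈ Γ := fun z hz => subset_closure ⟨z, hz, rfl⟩
  have hΓZ : ∀ z ∈ Z, ∃ p, (p, z) ∈ Γ := by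
    have hcl : closure S ⊆ Prod.snd '' Γ :=
      closure_minimal (fun z hz => ⟨_, hSΓ z hz, rfl⟩) (hΓ.image continuous_snd).isClosed
    intro z hz
    obtain ⟨⟨p, z⟩, hq, rfl⟩ := hcl (hS hz)
    exact ⟨p, hq⟩
  -- The compatible pairs `(F, y)` form a closed set. With `F` confined to the compact `K`, their
  -- `y`-projection is closed, so centres exist for all of `Z` and not only for the dense `Y`.
  set T : Set (E × E) := {a | ∀ q ∈ Γ, ∀ q' ∈ Γ,
    N (a.1 - q.1) - N (a.1 - q'.1) = μ * (N (a.2 - q.2) - N (a.2 - q'.2))}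
  have hT : IsClosed T := by
    simp only [T, ofPred_forall]
    refine isClosed_biInter fun q _ => isClosed_biInter fun q' _ => isClosed_eq ?_ ?_ <;> fun_prop
  have hYT : ∀ y ∈ Y, ∃ F ∈ K, (F, y) ∈ T := by
    intro y hy
    obtain ⟨F, hFK, hF⟩ := hprof y hy
    refine ⟨F, hFK, fun q hq q' hq' => ?_⟩
    have hcl : IsClosed {c : (E × E) × (E × E) |
        N (F - c.1.1) - N (F - c.2.1) = μ * (N (y - c.1.2) - N (y - c.2.2))} :=
      isClosed_eq (by fun_prop) (by fun_prop)
    have hmem : (q, q') ∈ closure (((fun z => (h z, z)) '' S) ×ˢ ((fun z => (h z, z)) '' S)) := by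
      rw [closure_prod_eq]; exact ⟨hq, hq'⟩
    refine closure_minimal ?_ hcl hmem
    rintro ⟨_, _⟩ ⟨⟨z, hz, rfl⟩, ⟨z', hz', rfl⟩⟩
    exact hF z hz z' hz'
  have hTcomp : IsCompact ((K ×ˢ Z) ∩ T) := (hK.prod hZcomp).inter_right hT
  have hext : ∀ y ∈ Z, ∃ F, (F, y) ∈ T := by
    have hcl : closure Y ⊆ Prod.snd '' ((K ×ˢ Z) ∩ T) :=
      closure_minimal (fun y hy => by
        obtain ⟨F, hFK, hF⟩ := hYT y hy
        exact ⟨(F, y), ⟨⟨hFK, hYZ hy⟩, hF⟩, rfl⟩) (hTcomp.image continuous_snd).isClosed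
    intro y hy
    obtain ⟨⟨F, y⟩, hq, rfl⟩ := hcl (hY hy)
    exact ⟨F, hq.2⟩
  have hdist := dist_eq_of_distance_profiles hN hμ hZconv hZint hΓ hΓZ (fun q hq => (hΓsub hq).2)
    hext
  have hex : ∀ z, ∃ p, z ∈ Z → (p, z) ∈ Γ := fun z => by
    by_cases hz : z ∈ Z
    · obtain ⟨p, hp⟩ := hΓZ z hz
      exact ⟨p, fun _ => hp⟩
    · exact ⟨0, fun h => absurd h hz⟩
  choose f hf using hex
  obtain ⟨U, b, hU, hfU⟩ := exists_linear_of_similarity hN hμ hZconv hZint (f := f)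
    fun x hx y hy => hdist _ (hf x hx) _ (hf y hy)
  refine ⟨U, b, hU, fun z hz => ?_, fun z hz => ?_⟩
  · change U z + b ∈ Z
    rw [← hfU z hz]
    exact (hΓsub (hf z hz)).1
  · rw [← hfU z (hSZ hz)]
    have := hdist _ (hSΓ z hz) _ (hf z (hSZ hz))
    simp only [sub_self, map_zero, mul_zero] at this
    exact sub_eq_zero.1 (hN _ this)

end Rigidity

/-! ### Isometries of symmetric norms are orthogonal. -/

section SymmetricNorms

variable {d : ℕ} {N : Seminorm ℝ (Fin d → ℝ)}

theorem measure_seminorm_closedBall_pos :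
    0 < volume (N.closedBall (0 : Fin d → ℝ) 1) := by
  have hopen : IsOpen {x | N x < 1} := isOpen_lt (seminorm_continuous N) continuous_const
  refine (hopen.measure_pos volume ⟨0, by simp⟩).trans_le (measure_mono fun x hx => ?_)
  rw [Seminorm.mem_closedBall, sub_zero]
  exact le_of_lt hx

/-- A linear isometry maps the unit ball onto itself, and this ball has finite positive volume, so
its determinant is `±1`. -/
theorem setIntegral_comp_of_isometry (hN : ∀ x, N x = 0 → x = 0)
    (V : (Fin d → ℝ) →ₗ[ℝ] (Fin d → ℝ)) (hV : ∀ x, N (V x) = N x) (f : (Fin d → ℝ) → ℝ) :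
    ∫ x in N.closedBall 0 1, f (V x) = ∫ x in N.closedBall 0 1, f x := by
  set K := N.closedBall (0 : Fin d → ℝ) 1
  have hK : IsCompact K := isCompact_seminorm_closedBall hN 0 1
  have hinj : Function.Injective V := (injective_iff_map_eq_zero V).2 fun x hx =>
    hN x (by rw [← hV, hx, map_zero])
  have himage : V '' K = K := by
    ext x
    constructor
    · rintro ⟨y, hy, rfl⟩
      simpa [K, Seminorm.mem_closedBall, hV] using hy
    · intro hx
      obtain ⟨y, rfl⟩ := LinearMap.injective_iff_surjective.1 hinj x
      exact ⟨y, by simpa [K, Seminorm.mem_closedBall, hV] using hx, rfl⟩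
  have hdet : |LinearMap.det V| = 1 := by
    have h := Measure.addHaar_image_linearMap volume V K
    rw [himage] at h
    have h1 : ENNReal.ofReal |LinearMap.det V| = 1 := by
      have := ENNReal.mul_left_inj measure_seminorm_closedBall_pos.ne' hK.measure_lt_top.ne
        (a := ENNReal.ofReal |LinearMap.det V|) (b := 1)
      rw [one_mul] at this
      exact this.1 h.symm
    rwa [ENNReal.ofReal_eq_one] at h1
  have h := integral_image_eq_integral_abs_det_fderiv_smul volume hK.isClosed.measurableSet
    (fun x _ => (LinearMap.toContinuousLinearMap V).hasFDerivAt.hasFDerivWithinAt)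
    hinj.injOn f
  rw [show (LinearMap.toContinuousLinearMap V : (Fin d → ℝ) → Fin d → ℝ) = V from rfl, himage] at h
  rw [h]
  simp [ContinuousLinearMap.det, hdet]

/-- A linear isometry of a norm that is invariant under sign changes and permutations of the
coordinates is orthogonal. -/
theorem mem_orthogonalGroup_of_isometry (hN : ∀ x, N x = 0 → x = 0)
    (habs : ∀ x y : Fin d → ℝ, (∀ k, |x k| = |y k|) → N x = N y)
    (hperm : ∀ (x : Fin d → ℝ) (σ : Equiv.Perm (Fin d)), N (fun k => x (σ k)) = N x)
    (V : Matrix (Fin d) (Fin d) ℝ) (hV : ∀ x, N (V *ᵥ x) = N x) :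
    V ∈ Matrix.orthogonalGroup (Fin d) ℝ := by
  set K := N.closedBall (0 : Fin d → ℝ) 1
  have hK : IsCompact K := isCompact_seminorm_closedBall hN 0 1
  have hint : ∀ k l (a : ℝ), IntegrableOn (fun x : Fin d → ℝ => a * (x k * x l)) K := fun k l a =>
    ContinuousOn.integrableOn_compact hK (by fun_prop)
  -- The second-moment matrix of the unit ball is scalar: a sign change in one coordinate kills the
  -- off-diagonal entries and swaps equate the diagonal ones. Invariance under `V` then reads `V * M
  -- * Vᵀ = M`.
  set M : Fin d → Fin d → ℝ := fun i j => ∫ x in K, x i * x j with hM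
  have hoff : ∀ i j, i ≠ j → M i j = 0 := by
    intro i j hij
    set Φ : (Fin d → ℝ) →ₗ[ℝ] (Fin d → ℝ) :=
      LinearMap.pi fun k => (if k = i then (-1 : ℝ) else 1) • LinearMap.proj k
    have h := setIntegral_comp_of_isometry hN Φ
      (fun x => habs _ _ fun k => by by_cases hk : k = i <;> simp [Φ, hk])
      (fun x => x i * x j)
    simp only [Φ, LinearMap.pi_apply, LinearMap.smul_apply, LinearMap.proj_apply, if_true,
      if_neg hij.symm, one_smul, smul_eq_mul, neg_mul, one_mul, integral_neg] at h
    change -M i j = M i j at h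
    linarith
  have hdiag : ∀ i j, M i i = M j j := by
    intro i j
    have h := setIntegral_comp_of_isometry hN (LinearMap.funLeft ℝ ℝ (Equiv.swap i j))
      (fun x => hperm x _) (fun x => x j * x j)
    simpa [LinearMap.funLeft_apply] using h
  have hpos : ∀ i, 0 < M i i := by
    intro i
    rw [hM]
    refine (setIntegral_pos_iff_support_of_nonneg_ae
      (Eventually.of_forall fun x : Fin d → ℝ => mul_self_nonneg (x i)) (by simpa using hint i i 1)).2 ?_
    set O : Set (Fin d → ℝ) := {x | N x < 1} ∩ {x | x i ≠ 0}
    have hO : IsOpen O := (isOpen_lt (seminorm_continuous N) continuous_const).inter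
      (isOpen_ne_fun (continuous_apply i) continuous_const)
    have hne : O.Nonempty := by
      set e : Fin d → ℝ := Pi.single i 1
      refine ⟨(N e + 1)⁻¹ • e, ?_, ?_⟩
      · have h0 : 0 ≤ N e := apply_nonneg N e
        change N _ < 1
        rw [map_smul_eq_mul, Real.norm_eq_abs, abs_of_pos (by positivity),
          inv_mul_lt_iff₀ (by positivity)]
        linarith
      · have h0 : 0 ≤ N e := apply_nonneg N e
        have : N e + 1 ≠ 0 := by positivity
        simpa [e] using this
    refine (hO.measure_pos volume hne).trans_le (measure_mono fun x hx => ⟨?_, ?_⟩)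
    · exact mul_self_ne_zero.2 hx.2
    · rw [Seminorm.mem_closedBall, sub_zero]
      exact le_of_lt hx.1
  rw [Matrix.mem_orthogonalGroup_iff]
  ext i j
  have hmoment : ∑ k, ∑ l, V i k * V j l * M k l = M i j := by
    have h := setIntegral_comp_of_isometry hN (Matrix.toLin' V) (by simpa using hV)
      (fun x => x i * x j)
    change _ = M i j at h
    rw [← h]
    have hexpand : ∀ x : Fin d → ℝ, Matrix.toLin' V x i * Matrix.toLin' V x j =
        ∑ k, ∑ l, V i k * V j l * (x k * x l) := by
      intro x
      simp only [Matrix.toLin'_apply, Matrix.mulVec, dotProduct, Finset.sum_mul_sum]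
      exact Finset.sum_congr rfl fun k _ => Finset.sum_congr rfl fun l _ => by ring
    simp only [hexpand]
    rw [integral_finsetSum _ fun k _ => integrable_finsetSum _ fun l _ => hint k l _]
    refine Finset.sum_congr rfl fun k _ => ?_
    rw [integral_finsetSum _ fun l _ => hint k l _]
    exact Finset.sum_congr rfl fun l _ => (integral_const_mul _ _).symm
  have hsum : ∑ k, ∑ l, V i k * V j l * M k l = M i i * ∑ k, V i k * V j k := by
    rw [Finset.mul_sum]
    refine Finset.sum_congr rfl fun k _ => ?_
    rw [Finset.sum_eq_single k (fun l _ hl => by rw [hoff k l hl.symm, mul_zero]) (by simp),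
      hdiag k i]
    ring
  rw [hsum] at hmoment
  have hentry : (V * Vᵀ) i j = ∑ k, V i k * V j k := by
    simp [Matrix.mul_apply]
  rw [hentry]
  rcases eq_or_ne i j with rfl | hij
  · rw [Matrix.one_apply_eq]
    exact mul_left_cancel₀ (hpos i).ne' (by rw [hmoment, mul_one])
  · rw [Matrix.one_apply_ne hij]
    rw [hoff i j hij] at hmoment
    exact (mul_eq_zero.1 hmoment).resolve_left (hpos i).ne'

theorem norm_toLp_eq_of_abs_eq {p : ℝ≥0∞} (hp : 1 ≤ p) {x y : Fin d → ℝ}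
    (h : ∀ k, |x k| = |y k|) : ‖WithLp.toLp p x‖ = ‖WithLp.toLp p y‖ := by
  rcases eq_or_ne p ⊤ with rfl | hp'
  · simp [PiLp.norm_eq_ciSup, Real.norm_eq_abs, h]
  · have : 0 < p.toReal := ENNReal.toReal_pos (zero_lt_one.trans_le hp).ne' hp'
    simp [PiLp.norm_eq_sum this, Real.norm_eq_abs, h]

theorem norm_toLp_comp_perm {p : ℝ≥0∞} (hp : 1 ≤ p) (x : Fin d → ℝ) (σ : Equiv.Perm (Fin d)) :
    ‖WithLp.toLp p (fun k => x (σ k))‖ = ‖WithLp.toLp p x‖ := by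
  rcases eq_or_ne p ⊤ with rfl | hp'
  · simp only [PiLp.norm_eq_ciSup]
    exact σ.iSup_comp (g := fun k => ‖x k‖)
  · have : 0 < p.toReal := ENNReal.toReal_pos (zero_lt_one.trans_le hp).ne' hp'
    simp only [PiLp.norm_eq_sum this]
    congr 1
    exact Equiv.sum_comp σ fun k => ‖x k‖ ^ p.toReal

end SymmetricNorms

/-! ### The limit of the contrastive loss and Gibbs' inequality. -/

section LossLimit

open ProbabilityTheory

theorem integrable_of_bounds {X : Type*} [MeasurableSpace X] {ν : Measure X} [IsFiniteMeasure ν]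
    {f : X → ℝ} (hf : Measurable f) {a b : ℝ} (hab : ∀ x, f x ∈ Icc a b) : Integrable f ν :=
  Integrable.of_mem_Icc a b hf.aemeasurable (Eventually.of_forall hab)

theorem integral_mem_Icc {X : Type*} [MeasurableSpace X] {ν : Measure X} [IsProbabilityMeasure ν]
    {f : X → ℝ} (hf : Measurable f) {a b : ℝ} (hab : ∀ x, f x ∈ Icc a b) :
    ∫ x, f x ∂ν ∈ Icc a b := by
  have hi := integrable_of_bounds (ν := ν) hf hab
  constructor
  · simpa using integral_mono (integrable_const a) hi fun x => (hab x).1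
  · simpa using integral_mono hi (integrable_const b) fun x => (hab x).2

theorem abs_log_sub_log_le {ε x y : ℝ} (hε : 0 < ε) (hx : ε ≤ x) (hy : ε ≤ y) :
    |Real.log x - Real.log y| ≤ ε⁻¹ * |x - y| := by
  have key : ∀ x y, ε ≤ x → ε ≤ y → Real.log x - Real.log y ≤ ε⁻¹ * |x - y| := by
    intro x y hx hy
    have hx0 : 0 < x := hε.trans_le hx
    have hy0 : 0 < y := hε.trans_le hy
    rw [← Real.log_div hx0.ne' hy0.ne']
    calc Real.log (x / y) ≤ x / y - 1 := Real.log_le_sub_one_of_pos (by positivity)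
      _ = y⁻¹ * (x - y) := by field_simp
      _ ≤ y⁻¹ * |x - y| := by gcongr; exact le_abs_self _
      _ ≤ ε⁻¹ * |x - y| := by gcongr
  rw [abs_sub_le_iff]
  exact ⟨key x y hx hy, by rw [abs_sub_comm]; exact key y x hy hx⟩

theorem integral_abs_average_sub_le {X : Type*} [MeasurableSpace X] {ν : Measure X}
    [IsProbabilityMeasure ν] {φ : X → ℝ} (hφ : Measurable φ) (hb : ∀ x, φ x ∈ Icc (0 : ℝ) 1)
    {M : ℕ} (hM : 0 < M) :
    ∫ n, |(∑ i, φ (n i)) / M - ∫ x, φ x ∂ν| ∂(Measure.pi fun _ : Fin M => ν) ≤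
      (√M)⁻¹ := by
  have hM' : (0 : ℝ) < M := Nat.cast_pos.2 hM
  set m := ∫ x, φ x ∂ν
  have hφL : MemLp φ 2 ν := MemLp.of_bound hφ.aestronglyMeasurable 1
    (Eventually.of_forall fun x => by
      rw [Real.norm_eq_abs, abs_of_nonneg (hb x).1]; exact (hb x).2)
  have hφi : Integrable φ ν := integrable_of_bounds hφ hb
  set P := Measure.pi fun _ : Fin M => ν
  set S : (Fin M → X) → ℝ := ∑ i, fun n => φ (n i) with hS
  have hSapp : ∀ n, S n = ∑ i, φ (n i) := fun n => by simp [hS]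
  have hcomp : ∀ i : Fin M, MemLp (fun n : Fin M → X => φ (n i)) 2 P := fun i =>
    hφL.comp_measurePreserving (measurePreserving_eval (fun _ : Fin M => ν) i)
  have hSL : MemLp S 2 P := memLp_finsetSum' _ fun i _ => hcomp i
  have hmean : ∫ n, S n ∂P = M * m := by
    simp only [hSapp]
    rw [integral_finsetSum _ fun i _ => (hcomp i).integrable one_le_two]
    have : ∀ i : Fin M, ∫ n, φ (n i) ∂P = m := fun i =>
      integral_comp_eval (μ := fun _ : Fin M => ν) hφ.aestronglyMeasurable
    simp [this]
  have hvar : ∫ n, (S n - M * m) ^ 2 ∂P ≤ M := by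
    rw [← hmean, ← variance_eq_integral hSL.aestronglyMeasurable.aemeasurable]
    rw [hS, variance_sum_pi fun _ => hφL]
    have h1 : Var[φ; ν] ≤ 1 := (variance_le_sq_of_bounded (Eventually.of_forall hb)
      hφ.aemeasurable).trans (by norm_num)
    calc ∑ _i : Fin M, Var[φ; ν] ≤ ∑ _i : Fin M, (1 : ℝ) := Finset.sum_le_sum fun _ _ => h1
      _ = M := by simp
  have hs : 0 < √(M : ℝ) := Real.sqrt_pos.2 hM'
  have hss : √(M : ℝ) * √(M : ℝ) = M := Real.mul_self_sqrt hM'.le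
  have hsq : Integrable (fun n => (S n - M * m) ^ 2) P :=
    (hSL.sub (memLp_const (M * m))).integrable_sq
  -- AM–GM in the form `2 * √M * |u| ≤ M + u ^ 2`, with `u` the centred sum. The weights are chosen
  -- so that the variance bound `M` makes both terms equal to half of `(√M)⁻¹`.
  have hpt : ∀ n, |(∑ i, φ (n i)) / M - m| ≤
      (√M)⁻¹ / 2 + ((√M)⁻¹ / (2 * M)) * (S n - M * m) ^ 2 := by
    intro n
    have h1 : (∑ i, φ (n i)) / M - m = (S n - M * m) / M := by rw [hSapp]; field_simp
    rw [h1, abs_div, abs_of_pos hM', div_le_iff₀ hM']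
    set u := S n - M * m
    have h2 : ((√(M : ℝ))⁻¹ / 2 + ((√(M : ℝ))⁻¹ / (2 * M)) * u ^ 2) * M =
        (√(M : ℝ))⁻¹ * (M + u ^ 2) / 2 := by field_simp
    rw [h2, ← sq_abs, le_div_iff₀ two_pos, inv_mul_eq_div, le_div_iff₀ hs]
    nlinarith [sq_nonneg (√(M : ℝ) - |u|)]
  calc ∫ n, |(∑ i, φ (n i)) / M - m| ∂P
      ≤ ∫ n, ((√M)⁻¹ / 2 + ((√M)⁻¹ / (2 * M)) * (S n - M * m) ^ 2) ∂P := by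
        refine integral_mono_of_nonneg (Eventually.of_forall fun n => abs_nonneg _)
          ((integrable_const _).add (hsq.const_mul _)) (Eventually.of_forall hpt)
    _ = (√M)⁻¹ / 2 + ((√M)⁻¹ / (2 * M)) * ∫ n, (S n - M * m) ^ 2 ∂P := by
        rw [integral_add (integrable_const _) (hsq.const_mul _), integral_const_mul]
        simp
    _ ≤ (√M)⁻¹ / 2 + ((√M)⁻¹ / (2 * M)) * M := by gcongr
    _ = (√M)⁻¹ := by field_simp; norm_num

/-- Above `ε` the logarithm is `ε⁻¹`-Lipschitz, so the error is controlled by that of the empirical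
mean plus `1 / M` for the positive term in the denominator. The rate does not depend on `a` or `φ`,
so it can be integrated over positive pairs. -/
theorem abs_integral_neg_log_sub_le {X : Type*} [MeasurableSpace X] {ν : Measure X}
    [IsProbabilityMeasure ν] {φ : X → ℝ} (hφ : Measurable φ) {ε : ℝ} (hε : 0 < ε)
    (hb : ∀ x, φ x ∈ Icc ε 1) {a : ℝ} (ha : a ∈ Icc ε 1) {M : ℕ} (hM : 0 < M) :
    |∫ n, -Real.log (a / (a + ∑ i, φ (n i))) ∂(Measure.pi fun _ : Fin M => ν) - Real.log M
      - -Real.log (a / ∫ x, φ x ∂ν)| ≤ ε⁻¹ * ((M : ℝ)⁻¹ + (√M)⁻¹) := by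
  have hM' : (0 : ℝ) < M := Nat.cast_pos.2 hM
  set P := Measure.pi fun _ : Fin M => ν
  set m := ∫ x, φ x ∂ν
  have hm : m ∈ Icc ε 1 := integral_mem_Icc hφ hb
  have ha0 : 0 < a := hε.trans_le ha.1
  have hm0 : 0 < m := hε.trans_le hm.1
  set T : (Fin M → X) → ℝ := fun n => (a + ∑ i, φ (n i)) / M with hT
  have hSlow : ∀ n : Fin M → X, M * ε ≤ ∑ i, φ (n i) := fun n => by
    calc M * ε = ∑ _i : Fin M, ε := by simp
      _ ≤ _ := Finset.sum_le_sum fun i _ => (hb (n i)).1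
  have hSup : ∀ n : Fin M → X, ∑ i, φ (n i) ≤ M := fun n => by
    calc ∑ i, φ (n i) ≤ ∑ _i : Fin M, (1 : ℝ) := Finset.sum_le_sum fun i _ => (hb (n i)).2
      _ = M := by simp
  have hTlow : ∀ n, ε ≤ T n := fun n => by
    rw [hT, le_div_iff₀ hM']
    have := hSlow n
    nlinarith
  have hTmeas : Measurable T := by
    refine (measurable_const.add ?_).div_const _
    exact Finset.measurable_fun_sum _ fun i _ => hφ.comp (measurable_pi_apply i)
  have hTup : ∀ n, T n ≤ (1 + M) / M := fun n => by
    rw [hT]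
    have := hSup n
    have := ha.2
    dsimp only
    gcongr
  have hlog : ∀ n : Fin M → X, -Real.log (a / (a + ∑ i, φ (n i))) =
      -Real.log a + Real.log M + Real.log (T n) := by
    intro n
    have hS0 : 0 < a + ∑ i, φ (n i) := by
      have := hSlow n
      have : 0 < M * ε := by positivity
      linarith
    rw [hT, Real.log_div ha0.ne' hS0.ne', Real.log_div hS0.ne' hM'.ne']
    ring
  have hTi : Integrable (fun n => Real.log (T n)) P :=
    integrable_of_bounds (a := Real.log ε) (b := Real.log ((1 + M) / M))
      (Real.measurable_log.comp hTmeas)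
      fun n => ⟨Real.log_le_log hε (hTlow n), Real.log_le_log (hε.trans_le (hTlow n)) (hTup n)⟩
  have hSi : Integrable (fun n => |(∑ i, φ (n i)) / M - m|) P := by
    refine integrable_of_bounds (a := 0) (b := 1) ?_ fun n => ⟨abs_nonneg _, ?_⟩
    · refine Measurable.abs (((Finset.measurable_fun_sum _ fun i _ =>
        hφ.comp (measurable_pi_apply i)).div_const _).sub_const _)
    · have h1 : (∑ i, φ (n i)) / M ≤ 1 := by rw [div_le_one hM']; exact hSup n
      have h2 : 0 ≤ (∑ i, φ (n i)) / M := div_nonneg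
        (Finset.sum_nonneg fun i _ => hε.le.trans (hb (n i)).1) hM'.le
      rw [abs_le]
      constructor <;> linarith [hm.2]
  have hpt : ∀ n, |Real.log (T n) - Real.log m| ≤
      ε⁻¹ * ((M : ℝ)⁻¹ + |(∑ i, φ (n i)) / M - m|) := by
    intro n
    refine (abs_log_sub_log_le hε (hTlow n) hm.1).trans ?_
    gcongr
    have : T n - m = a / M + ((∑ i, φ (n i)) / M - m) := by rw [hT]; ring
    rw [this]
    refine (abs_add_le _ _).trans ?_
    gcongr
    rw [abs_of_pos (by positivity), div_eq_mul_inv]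
    exact mul_le_of_le_one_left (by positivity) ha.2
  have hI : ∫ n, -Real.log (a / (a + ∑ i, φ (n i))) ∂P - Real.log M - -Real.log (a / m) =
      ∫ n, (Real.log (T n) - Real.log m) ∂P := by
    simp only [hlog]
    rw [integral_add (integrable_const _) hTi, integral_sub hTi (integrable_const _),
      Real.log_div ha0.ne' hm0.ne']
    simp
    ring
  rw [hI]
  calc |∫ n, (Real.log (T n) - Real.log m) ∂P| ≤ ∫ n, |Real.log (T n) - Real.log m| ∂P :=
        abs_integral_le_integral_abs
    _ ≤ ∫ n, ε⁻¹ * ((M : ℝ)⁻¹ + |(∑ i, φ (n i)) / M - m|) ∂P :=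
        integral_mono_of_nonneg (Eventually.of_forall fun n => abs_nonneg _)
          (((integrable_const _).add hSi).const_mul _) (Eventually.of_forall hpt)
    _ = ε⁻¹ * ((M : ℝ)⁻¹ + ∫ n, |(∑ i, φ (n i)) / M - m| ∂P) := by
        rw [integral_const_mul, integral_add (integrable_const _) hSi]
        simp
    _ ≤ ε⁻¹ * ((M : ℝ)⁻¹ + (√M)⁻¹) := by
        gcongr
        exact integral_abs_average_sub_le hφ (fun x => ⟨hε.le.trans (hb x).1, (hb x).2⟩) hM

/-- The contrastive loss with critic `c`, normalised by `log M`, converges to the cross entropy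
of the density proportional to the critic. -/
theorem tendsto_contrastive_loss {W X : Type*} [MeasurableSpace W] [MeasurableSpace X]
    {ν : Measure X} [IsProbabilityMeasure ν] {P : Measure (W × X)} [IsProbabilityMeasure P]
    {c : W → X → ℝ} (hc : Measurable (Function.uncurry c)) {ε : ℝ} (hε : 0 < ε)
    (hb : ∀ w x, c w x ∈ Icc ε 1) :
    Tendsto (fun M : ℕ => ∫ p, ∫ n : Fin M → X,
        -Real.log (c p.1 p.2 / (c p.1 p.2 + ∑ i, c p.1 (n i))) ∂(Measure.pi fun _ => ν) ∂P
        - Real.log M) atTop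
      (𝓝 (∫ p, -Real.log (c p.1 p.2 / ∫ x, c p.1 x ∂ν) ∂P)) := by
  set m : W → ℝ := fun w => ∫ x, c w x ∂ν with hm
  have hcw : ∀ w, Measurable (c w) := fun w => hc.comp measurable_prodMk_left
  have hmI : ∀ w, m w ∈ Icc ε 1 := fun w => integral_mem_Icc (hcw w) (hb w)
  have hmm : Measurable m := (hc.stronglyMeasurable.integral_prod_right).measurable
  have hJm : Measurable fun p : W × X => -Real.log (c p.1 p.2 / m p.1) :=
    (Real.measurable_log.comp (hc.div (hmm.comp measurable_fst))).neg
  have hJb : ∀ p : W × X, -Real.log (c p.1 p.2 / m p.1) ∈ Icc (-Real.log (1 / ε))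
      (-Real.log (ε / 1)) := fun p => by
    have h1 := hb p.1 p.2
    have h2 := hmI p.1
    have h3 : 0 < c p.1 p.2 := hε.trans_le h1.1
    have h4 : 0 < m p.1 := hε.trans_le h2.1
    constructor
    · refine neg_le_neg (Real.log_le_log (by positivity) ?_)
      exact div_le_div₀ zero_le_one h1.2 hε h2.1
    · refine neg_le_neg (Real.log_le_log (by positivity) ?_)
      exact div_le_div₀ h3.le h1.1 h4 h2.2
  have hJi := integrable_of_bounds (ν := P) hJm hJb
  have hlim : Tendsto (fun M : ℕ => ε⁻¹ * ((M : ℝ)⁻¹ + (√M)⁻¹)) atTop (𝓝 0) := by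
    have h1 := tendsto_inv_atTop_nhds_zero_nat (𝕜 := ℝ)
    have h2 : Tendsto (fun M : ℕ => (√(M : ℝ))⁻¹) atTop (𝓝 0) :=
      tendsto_inv_atTop_zero.comp (Real.tendsto_sqrt_atTop.comp tendsto_natCast_atTop_atTop)
    simpa using (h1.add h2).const_mul ε⁻¹
  rw [tendsto_iff_norm_sub_tendsto_zero]
  refine squeeze_zero' (Eventually.of_forall fun _ => norm_nonneg _) ?_ hlim
  filter_upwards [eventually_gt_atTop 0] with M hM
  set I : W × X → ℝ := fun p => ∫ n : Fin M → X,
    -Real.log (c p.1 p.2 / (c p.1 p.2 + ∑ i, c p.1 (n i))) ∂(Measure.pi fun _ => ν) with hI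
  have hpt : ∀ p, |I p - Real.log M - -Real.log (c p.1 p.2 / m p.1)| ≤
      ε⁻¹ * ((M : ℝ)⁻¹ + (√M)⁻¹) := fun p =>
    abs_integral_neg_log_sub_le (hcw p.1) hε (hb p.1) (hb p.1 p.2) hM
  have hIm : Measurable I := by
    have hm1 : Measurable fun q : (W × X) × (Fin M → X) => c q.1.1 q.1.2 :=
      hc.comp measurable_fst
    have hm2 : Measurable fun q : (W × X) × (Fin M → X) => ∑ i, c q.1.1 (q.2 i) :=
      Finset.measurable_fun_sum _ fun i _ => hc.comp
        (f := fun q : (W × X) × (Fin M → X) => (q.1.1, q.2 i)) (by fun_prop)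
    have := (Real.measurable_log.comp (hm1.div (hm1.add hm2))).neg
    exact (this.stronglyMeasurable.integral_prod_right' (ν := Measure.pi fun _ => ν)).measurable
  have hIi : Integrable I P := by
    have hdi : Integrable (fun p => I p - Real.log M - -Real.log (c p.1 p.2 / m p.1)) P :=
      integrable_of_bounds ((hIm.sub_const _).sub hJm) fun p => abs_le.1 (hpt p)
    have := (hdi.add hJi).add (integrable_const (Real.log M))
    refine this.congr (Eventually.of_forall fun p => ?_)
    simp
  have hdiff : ∫ p, I p ∂P - Real.log M - ∫ p, -Real.log (c p.1 p.2 / m p.1) ∂P =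
      ∫ p, (I p - Real.log M - -Real.log (c p.1 p.2 / m p.1)) ∂P := by
    have h1 : ∫ p, (I p - Real.log M) ∂P = ∫ p, I p ∂P - Real.log M := by
      rw [integral_sub hIi (integrable_const _)]
      simp
    rw [← h1]
    exact (integral_sub (hIi.sub (integrable_const _)) hJi).symm
  rw [hdiff]
  have := norm_integral_le_of_norm_le_const (μ := P)
    (f := fun p => I p - Real.log M - -Real.log (c p.1 p.2 / m p.1)) (Eventually.of_forall hpt)
  simpa using this

/-- Gibbs' inequality with its equality case. -/
theorem ae_eq_of_integral_log_le {Y : Type*} [MeasurableSpace Y] {lam : Measure Y}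
    [IsProbabilityMeasure lam] {k q : Y → ℝ} (hk : Measurable k) (hq : Measurable q) {a b : ℝ}
    (ha : 0 < a) (hkb : ∀ y, k y ∈ Icc a b) (hqb : ∀ y, q y ∈ Icc a b)
    (hkq : ∫ y, k y ∂lam = ∫ y, q y ∂lam)
    (hle : ∫ y, -Real.log (k y) ∂(lam.withDensity fun y => ENNReal.ofReal (q y)) ≤
      ∫ y, -Real.log (q y) ∂(lam.withDensity fun y => ENNReal.ofReal (q y))) :
    k =ᵐ[lam] q := by
  set P := lam.withDensity fun y => ENNReal.ofReal (q y)
  have hk0 : ∀ y, 0 < k y := fun y => ha.trans_le (hkb y).1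
  have hq0 : ∀ y, 0 < q y := fun y => ha.trans_le (hqb y).1
  have hqi : Integrable q lam := integrable_of_bounds hq hqb
  have hPfin : IsFiniteMeasure P := isFiniteMeasure_withDensity_ofReal hqi.hasFiniteIntegral
  have hint : ∀ f : Y → ℝ, ∫ y, f y ∂P = ∫ y, q y * f y ∂lam := fun f => by
    rw [integral_withDensity_eq_integral_toReal_smul hq.ennreal_ofReal
      (Eventually.of_forall fun y => ENNReal.ofReal_lt_top)]
    refine integral_congr_ae (Eventually.of_forall fun y => ?_)
    simp [ENNReal.toReal_ofReal (hq0 y).le]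
  have hti : Integrable (fun y => k y / q y) P :=
    integrable_of_bounds (hk.div hq) (a := 0) (b := b / a) fun y =>
      ⟨(div_pos (hk0 y) (hq0 y)).le,
        div_le_div₀ ((hk0 y).le.trans (hkb y).2) (hkb y).2 ha (hqb y).1⟩
  have hlogi : ∀ {f : Y → ℝ}, Measurable f → (∀ y, f y ∈ Icc a b) →
      Integrable (fun y => -Real.log (f y)) P := fun {f} hf hfb =>
    (integrable_of_bounds (Real.measurable_log.comp hf) (a := Real.log a) (b := Real.log b)
      fun y => ⟨Real.log_le_log ha (hfb y).1,
        Real.log_le_log (ha.trans_le (hfb y).1) (hfb y).2⟩).neg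
  have hmass : ∫ y, k y / q y ∂P = ∫ _, (1 : ℝ) ∂P := by
    rw [hint, hint, ← (by simp : ∫ y, q y ∂lam = ∫ y, q y * 1 ∂lam), ← hkq]
    refine integral_congr_ae (Eventually.of_forall fun y => ?_)
    have := (hq0 y).ne'
    field_simp
  -- This is `t - 1 - log t` at `t = k / q`, which is nonnegative and vanishes only at `t = 1`.
  -- Equal masses make `t - 1` integrate to zero, so `hle` forces the integral of `ψ` to vanish.
  set ψ : Y → ℝ := fun y => k y / q y - 1 + (-Real.log (k y) - -Real.log (q y)) with hψ
  have hψlog : ∀ y, ψ y = k y / q y - 1 - Real.log (k y / q y) := fun y => by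
    rw [hψ, Real.log_div (hk0 y).ne' (hq0 y).ne']
    ring
  have hψ0 : ∀ y, 0 ≤ ψ y := fun y => by
    rw [hψlog]
    linarith [Real.log_le_sub_one_of_pos (div_pos (hk0 y) (hq0 y))]
  have hψi : Integrable ψ P :=
    (hti.sub (integrable_const 1)).add ((hlogi hk hkb).sub (hlogi hq hqb))
  have hψint : ∫ y, ψ y ∂P = 0 := by
    refine le_antisymm ?_ (integral_nonneg hψ0)
    have h1 : ∫ y, ψ y ∂P = ∫ y, (k y / q y - 1) ∂P +
        ∫ y, (-Real.log (k y) - -Real.log (q y)) ∂P :=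
      integral_add (hti.sub (integrable_const 1)) ((hlogi hk hkb).sub (hlogi hq hqb))
    rw [h1, integral_sub hti (integrable_const 1), integral_sub (hlogi hk hkb) (hlogi hq hqb),
      hmass]
    linarith
  have hae := (integral_eq_zero_iff_of_nonneg hψ0 hψi).1 hψint
  have hae' := (ae_withDensity_iff hq.ennreal_ofReal).1 hae
  filter_upwards [hae'] with y hy
  have h1 : ψ y = 0 := hy (by simpa using hq0 y)
  rw [hψlog] at h1
  by_contra hne
  have hne' : k y / q y ≠ 1 := fun h => hne ((div_eq_one_iff_eq (hq0 y).ne').1 h)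
  linarith [Real.log_lt_sub_one_of_pos (div_pos (hk0 y) (hq0 y)) hne']

end LossLimit

/-! ### Continuous encoders realising a given self-map of the body. -/

section Competitor

/-- Radial projection towards an interior point `c`, scaled by the gauge of the body recentred at
`c`. -/
theorem exists_continuous_retraction {E : Type*} [NormedAddCommGroup E] [NormedSpace ℝ E]
    {Z : Set E} (hZ : Convex ℝ Z) (hcl : IsClosed Z) (hint : (interior Z).Nonempty) :
    ∃ ret : E → E, Continuous ret ∧ (∀ x, ret x ∈ Z) ∧ ∀ x ∈ Z, ret x = x := by
  obtain ⟨c, hc⟩ := hint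
  set Z' : Set E := (fun x => c + x) ⁻¹' Z
  have hconv : Convex ℝ Z' := hZ.translate_preimage_right c
  have hnhds : Z' ∈ 𝓝 (0 : E) :=
    (by fun_prop : Continuous fun x : E => c + x).continuousAt.preimage_mem_nhds (by
      simpa using mem_interior_iff_mem_nhds.1 hc)
  have hcl' : IsClosed Z' := hcl.preimage (by fun_prop)
  have hmem : ∀ x, gauge Z' x ≤ 1 ↔ c + x ∈ Z := fun x => by
    rw [gauge_le_one_iff_mem_closure hconv hnhds, hcl'.closure_eq]
    rfl
  have hpos : ∀ x, 0 < max 1 (gauge Z' (x - c)) := fun x => zero_lt_one.trans_le (le_max_left _ _)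
  have hgc : Continuous fun x => gauge Z' (x - c) :=
    (continuous_gauge hconv hnhds).comp (continuous_id.sub continuous_const)
  refine ⟨fun x => c + (max 1 (gauge Z' (x - c)))⁻¹ • (x - c), ?_, fun x => ?_, fun x hx => ?_⟩
  · have hinv : Continuous fun x => (max 1 (gauge Z' (x - c)))⁻¹ :=
      (continuous_const.max hgc).inv₀ fun x => (hpos x).ne'
    exact continuous_const.add (hinv.smul (continuous_id.sub continuous_const))
  · rw [← hmem, gauge_smul_of_nonneg (inv_pos.2 (hpos x)).le, smul_eq_mul,
      inv_mul_le_iff₀ (hpos x), mul_one]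
    exact le_max_right _ _
  · have h1 : gauge Z' (x - c) ≤ 1 := (hmem _).2 (by simpa using hx)
    simp [max_eq_left h1]

/-- The inverse of a continuous injection of a convex body, followed by a continuous self-map of
the body, extends to a continuous encoder. -/
theorem exists_continuous_encoder {d D : ℕ} {Z : Set (Fin d → ℝ)} (hZconv : Convex ℝ Z)
    (hZcomp : IsCompact Z) (hZint : (interior Z).Nonempty)
    {g : (Fin d → ℝ) → EuclideanSpace ℝ (Fin D)} (hg : ContinuousOn g Z) (hginj : InjOn g Z)
    {s : (Fin d → ℝ) → Fin d → ℝ} (hs : Continuous s) (hsZ : MapsTo s Z Z) :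
    ∃ r : EuclideanSpace ℝ (Fin D) → Fin d → ℝ,
      Continuous r ∧ (∀ x, r x ∈ Z) ∧ ∀ z ∈ Z, r (g z) = s z := by
  obtain ⟨ret, hretc, hretZ, hret⟩ := exists_continuous_retraction hZconv hZcomp.isClosed hZint
  have := isCompact_iff_compactSpace.1 hZcomp
  -- Compactness of `Z` makes the injection a closed embedding, so Tietze extends the encoder from
  -- `g '' Z`; the retraction brings its values back into `Z`.
  have he : IsClosedEmbedding (Z.domRestrict g) :=
    (continuousOn_iff_continuous_domRestrict.1 hg).isClosedEmbedding (injOn_iff_injective.1 hginj)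
  obtain ⟨G, hG⟩ := ContinuousMap.exists_extension' he
    (⟨fun z : Z => s z, hs.comp continuous_subtype_val⟩ : C(Z, Fin d → ℝ))
  refine ⟨fun x => ret (G x), hretc.comp G.continuous, fun x => hretZ _, fun z hz => ?_⟩
  have h : G (g z) = s z := congrFun hG ⟨z, hz⟩
  change ret (G (g z)) = s z
  rw [h, hret _ (hsZ hz)]

end Competitor

/-! ### Densities proportional to a bounded critic. -/

section NormalizedCritic

variable {W X : Type*} [MeasurableSpace W] [MeasurableSpace X]

/-- The density with respect to `ν` that is proportional to the critic. -/
def normalizedCritic (ν : Measure X) (c : W → X → ℝ) (p : W × X) : ℝ :=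
  c p.1 p.2 / ∫ x, c p.1 x ∂ν

variable {ν : Measure X} [IsProbabilityMeasure ν] {c : W → X → ℝ} {ε : ℝ}

theorem measurable_normalizedCritic (hc : Measurable (Function.uncurry c)) :
    Measurable (normalizedCritic ν c) :=
  hc.div ((hc.stronglyMeasurable.integral_prod_right).measurable.comp measurable_fst)

theorem integral_critic_mem_Icc (hc : Measurable (Function.uncurry c))
    (hb : ∀ w x, c w x ∈ Icc ε 1) (w : W) : ∫ x, c w x ∂ν ∈ Icc ε 1 :=
  integral_mem_Icc (hc.comp measurable_prodMk_left) (hb w)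

theorem normalizedCritic_mem_Icc (hc : Measurable (Function.uncurry c)) (hε : 0 < ε)
    (hb : ∀ w x, c w x ∈ Icc ε 1) (p : W × X) : normalizedCritic ν c p ∈ Icc ε ε⁻¹ := by
  have h1 := hb p.1 p.2
  have h2 := integral_critic_mem_Icc (ν := ν) hc hb p.1
  rw [normalizedCritic]
  constructor
  · rw [le_div_iff₀ (hε.trans_le h2.1)]
    exact (mul_le_of_le_one_right hε.le h2.2).trans h1.1
  · rw [inv_eq_one_div]
    exact div_le_div₀ zero_le_one h1.2 hε h2.1

theorem integral_normalizedCritic {ρ : Measure W} [IsProbabilityMeasure ρ]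
    (hc : Measurable (Function.uncurry c)) (hε : 0 < ε) (hb : ∀ w x, c w x ∈ Icc ε 1) :
    ∫ p, normalizedCritic ν c p ∂(ρ.prod ν) = 1 := by
  rw [integral_prod _ (integrable_of_bounds (measurable_normalizedCritic hc)
    (normalizedCritic_mem_Icc hc hε hb))]
  have : ∀ w, ∫ x, normalizedCritic ν c (w, x) ∂ν = 1 := fun w => by
    simp only [normalizedCritic]
    rw [integral_div, div_self (hε.trans_le (integral_critic_mem_Icc hc hb w).1).ne']
  simp [this]

theorem isProbabilityMeasure_withDensity_normalizedCritic {ρ : Measure W} [IsProbabilityMeasure ρ]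
    (hc : Measurable (Function.uncurry c)) (hε : 0 < ε) (hb : ∀ w x, c w x ∈ Icc ε 1) :
    IsProbabilityMeasure
      ((ρ.prod ν).withDensity fun p => ENNReal.ofReal (normalizedCritic ν c p)) := by
  refine ⟨?_⟩
  rw [withDensity_apply _ MeasurableSet.univ, Measure.restrict_univ,
    ← ofReal_integral_eq_lintegral_ofReal (integrable_of_bounds (measurable_normalizedCritic hc)
      (normalizedCritic_mem_Icc hc hε hb)) (Eventually.of_forall fun p =>
        hε.le.trans (normalizedCritic_mem_Icc hc hε hb p).1),
    integral_normalizedCritic hc hε hb, ENNReal.ofReal_one]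

end NormalizedCritic

/-! ### Minimizers reproduce the true conditional density. -/

section Model

variable {d L D : ℕ} {Z : Set (Fin d → ℝ)} {N : Seminorm ℝ (Fin d → ℝ)}
  {A B : Fin L → Matrix (Fin d) (Fin d) ℝ} {ρ : Measure (Fin L → Fin d → ℝ)} {μ : ℝ}
  {h : (Fin d → ℝ) → Fin d → ℝ}

/-- The critic of a model as a function of the latent states, where `h` is the encoder composed
with the generator. -/
def latentCritic (N : Seminorm ℝ (Fin d → ℝ)) (μ : ℝ) (h : (Fin d → ℝ) → Fin d → ℝ)
    (B : Fin L → Matrix (Fin d) (Fin d) ℝ) (w : Fin L → Fin d → ℝ) (z : Fin d → ℝ) : ℝ :=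
  Real.exp (-N (transition B (fun τ => h (w τ)) - h z) / μ)

theorem continuous_transition (B : Fin L → Matrix (Fin d) (Fin d) ℝ) :
    Continuous (transition B) := by
  unfold transition
  exact continuous_finsetSum _ fun τ _ => (continuous_const (y := B τ)).matrix_mulVec
    (continuous_apply τ)

theorem transition_smul (B : Fin L → Matrix (Fin d) (Fin d) ℝ) (a : ℝ) (w : Fin L → Fin d → ℝ) :
    transition B (fun τ => a • w τ) = a • transition B w := by
  simp [transition, Matrix.mulVec_smul, Finset.smul_sum]

theorem measurable_latentCritic (hh : Measurable h) :
    Measurable (Function.uncurry (latentCritic N μ h B)) := by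
  have hN := (seminorm_continuous N).measurable
  have hT := (continuous_transition B).measurable
  have h1 : Measurable fun p : (Fin L → Fin d → ℝ) × (Fin d → ℝ) =>
      transition B (fun τ => h (p.1 τ)) :=
    hT.comp (measurable_pi_lambda _ fun τ =>
      hh.comp ((measurable_pi_apply τ).comp measurable_fst))
  exact Real.measurable_exp.comp
    ((hN.comp (h1.sub (hh.comp measurable_snd))).neg.div_const _)

theorem exists_latentCritic_mem_Icc (hZcomp : IsCompact Z) (hμ : 0 < μ) (hhZ : ∀ z, h z ∈ Z) :
    ∃ ε, 0 < ε ∧ ∀ w z, latentCritic N μ h B w z ∈ Icc ε 1 := by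
  have hcomp : IsCompact ((univ.pi fun _ : Fin L => Z) ×ˢ Z) :=
    (isCompact_univ_pi fun _ => hZcomp).prod hZcomp
  have hcont : Continuous fun p : (Fin L → Fin d → ℝ) × (Fin d → ℝ) =>
      N (transition B p.1 - p.2) :=
    (seminorm_continuous N).comp (((continuous_transition B).comp continuous_fst).sub
      continuous_snd)
  obtain ⟨C, hC⟩ := (hcomp.image hcont).bddAbove
  refine ⟨Real.exp (-C / μ), Real.exp_pos _, fun w z => ⟨Real.exp_le_exp.2 ?_,
    Real.exp_le_one_iff.2 ?_⟩⟩
  · have : N (transition B (fun τ => h (w τ)) - h z) ≤ C :=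
      hC ⟨(fun τ => h (w τ), h z), ⟨fun τ _ => hhZ _, hhZ z⟩, rfl⟩
    gcongr
  · exact div_nonpos_of_nonpos_of_nonneg (neg_nonpos.2 (apply_nonneg N _)) hμ.le

theorem measure_convexBody_ne (hZcomp : IsCompact Z) (hZint : (interior Z).Nonempty) :
    volume Z ≠ 0 ∧ volume Z ≠ ⊤ :=
  ⟨(Measure.measure_pos_of_nonempty_interior volume hZint).ne', hZcomp.measure_lt_top.ne⟩

theorem isProbabilityMeasure_uniformLaw (hZcomp : IsCompact Z) (hZint : (interior Z).Nonempty) :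
    IsProbabilityMeasure (uniformLaw Z) := by
  obtain ⟨h0, ht⟩ := measure_convexBody_ne hZcomp hZint
  exact ⟨by simp [uniformLaw, ENNReal.inv_mul_cancel h0 ht]⟩

theorem ae_uniformLaw_iff (hZcomp : IsCompact Z) (hZint : (interior Z).Nonempty)
    {P : (Fin d → ℝ) → Prop} :
    (∀ᵐ z ∂uniformLaw Z, P z) ↔ ∀ᵐ z ∂volume.restrict Z, P z := by
  obtain ⟨h0, ht⟩ := measure_convexBody_ne hZcomp hZint
  rw [uniformLaw]
  exact Measure.ae_ennreal_smul_measure_iff (ENNReal.inv_ne_zero.2 ht)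

/-- The competitor: by linearity of the transition, scaling the states by `μ` scales the exponent by
`μ`, which cancels the temperature. -/
theorem integral_latentCritic_of_eqOn (hZcomp : IsCompact Z) (hμ : 0 < μ)
    (hh : ∀ z ∈ Z, h z = μ • z) {w : Fin L → Fin d → ℝ} (hw : ∀ τ, w τ ∈ Z) :
    (∀ z ∈ Z, latentCritic N μ h A w z = Real.exp (-N (z - transition A w))) ∧
      ∫ z, latentCritic N μ h A w z ∂uniformLaw Z =
        (volume Z)⁻¹.toReal * partitionFn N Z (transition A w) := by
  have h1 : ∀ z ∈ Z, latentCritic N μ h A w z = Real.exp (-N (z - transition A w)) := by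
    intro z hz
    have : (fun τ => h (w τ)) = fun τ => μ • w τ := funext fun τ => hh _ (hw τ)
    rw [latentCritic, this, transition_smul, hh z hz, ← smul_sub, map_smul_eq_mul,
      Real.norm_eq_abs, abs_of_pos hμ, map_sub_rev, ← mul_neg, mul_div_cancel_left₀ _ hμ.ne']
  refine ⟨h1, ?_⟩
  rw [uniformLaw, integral_smul_measure, smul_eq_mul, partitionFn]
  congr 1
  exact setIntegral_congr_fun hZcomp.isClosed.measurableSet h1

/-- The law of a positive pair has the normalized critic of the ground-truth model as density. -/
theorem positiveLaw_eq_withDensity [IsProbabilityMeasure ρ] (hZcomp : IsCompact Z)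
    (hZint : (interior Z).Nonempty) (hρZ : ∀ᵐ w ∂ρ, ∀ τ, w τ ∈ Z) (hμ : 0 < μ)
    (hh : ∀ z ∈ Z, h z = μ • z) :
    positiveLaw N Z A ρ = (ρ.prod (uniformLaw Z)).withDensity fun p =>
      ENNReal.ofReal (normalizedCritic (uniformLaw Z) (latentCritic N μ h A) p) := by
  obtain ⟨h0, ht⟩ := measure_convexBody_ne hZcomp hZint
  have hprod : ρ.prod (uniformLaw Z) = (volume Z)⁻¹ • ρ.prod (volume.restrict Z) := by
    have := isProbabilityMeasure_uniformLaw hZcomp hZint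
    refine (Measure.prod_eq fun s t hs hts => ?_)
    simp only [uniformLaw, Measure.smul_apply, Measure.prod_prod, smul_eq_mul]
    ring
  have hinv : (volume Z)⁻¹ ≠ ⊤ := ENNReal.inv_ne_top.2 h0
  rw [hprod, withDensity_smul_measure, ← withDensity_smul' _ _ hinv, positiveLaw]
  refine withDensity_congr_ae ?_
  have h1 : ∀ᵐ p ∂ρ.prod (volume.restrict Z), ∀ τ, p.1 τ ∈ Z :=
    Measure.quasiMeasurePreserving_fst.ae hρZ
  have h2 : ∀ᵐ p ∂ρ.prod (volume.restrict Z), p.2 ∈ Z :=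
    Measure.quasiMeasurePreserving_snd.ae (ae_restrict_mem hZcomp.isClosed.measurableSet)
  filter_upwards [h1, h2] with p hp1 hp2
  obtain ⟨h3, h4⟩ := integral_latentCritic_of_eqOn (N := N) (A := A) hZcomp hμ hh hp1
  have hv : 0 < (volume Z)⁻¹.toReal := ENNReal.toReal_pos (ENNReal.inv_ne_zero.2 ht) hinv
  rw [Pi.smul_apply, smul_eq_mul, ← ENNReal.ofReal_toReal hinv, ← ENNReal.ofReal_mul hv.le,
    normalizedCritic, h4, h3 _ hp2, condDensity]
  congr 1
  field_simp

variable {g : (Fin d → ℝ) → EuclideanSpace ℝ (Fin D)} {r : EuclideanSpace ℝ (Fin D) → Fin d → ℝ}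

theorem contrastiveLoss_eq_latent [IsProbabilityMeasure ρ] (hZcomp : IsCompact Z)
    (hZint : (interior Z).Nonempty) (hρZ : ∀ᵐ w ∂ρ, ∀ τ, w τ ∈ Z)
    (hrh : ∀ z ∈ Z, r (g z) = h z) (M : ℕ) :
    contrastiveLoss N Z A ρ g μ M r B = ∫ p, ∫ n : Fin M → Fin d → ℝ,
      -Real.log (latentCritic N μ h B p.1 p.2 /
        (latentCritic N μ h B p.1 p.2 + ∑ i, latentCritic N μ h B p.1 (n i)))
      ∂(Measure.pi fun _ => uniformLaw Z) ∂(positiveLaw N Z A ρ) := by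
  have := isProbabilityMeasure_uniformLaw hZcomp hZint
  have hZm := hZcomp.isClosed.measurableSet
  have hcrit : ∀ w : Fin L → Fin d → ℝ, (∀ τ, w τ ∈ Z) → ∀ z ∈ Z,
      critic N g μ r B w z = latentCritic N μ h B w z := by
    intro w hw z hz
    have : (fun τ => r (g (w τ))) = fun τ => h (w τ) := funext fun τ => hrh _ (hw τ)
    rw [critic, latentCritic, this, hrh z hz]
  have h1 : ∀ᵐ p ∂positiveLaw N Z A ρ, ∀ τ, p.1 τ ∈ Z :=
    (withDensity_absolutelyContinuous _ _).ae_le (Measure.quasiMeasurePreserving_fst.ae hρZ)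
  have h2 : ∀ᵐ p ∂positiveLaw N Z A ρ, p.2 ∈ Z :=
    (withDensity_absolutelyContinuous _ _).ae_le
      (Measure.quasiMeasurePreserving_snd.ae (ae_restrict_mem hZm))
  have h3 : ∀ᵐ n ∂(Measure.pi fun _ : Fin M => uniformLaw Z), ∀ i, n i ∈ Z :=
    ae_all_iff.2 fun i => (Measure.quasiMeasurePreserving_eval _ i).ae
      ((ae_uniformLaw_iff hZcomp hZint).2 (ae_restrict_mem hZm))
  rw [contrastiveLoss]
  refine integral_congr_ae ?_
  filter_upwards [h1, h2] with p hp1 hp2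
  refine integral_congr_ae ?_
  filter_upwards [h3] with n hn
  rw [hcrit _ hp1 _ hp2, Finset.sum_congr rfl fun i _ => hcrit _ hp1 _ (hn i)]

theorem asymptoticLoss_eq [IsProbabilityMeasure ρ] [IsProbabilityMeasure (positiveLaw N Z A ρ)]
    (hZcomp : IsCompact Z)
    (hZint : (interior Z).Nonempty) (hρZ : ∀ᵐ w ∂ρ, ∀ τ, w τ ∈ Z) (hμ : 0 < μ)
    (hh : Measurable h) (hhZ : ∀ z, h z ∈ Z) (hrh : ∀ z ∈ Z, r (g z) = h z) :
    asymptoticLoss N Z A ρ g μ (r, B) =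
      ((∫ p, -Real.log (normalizedCritic (uniformLaw Z) (latentCritic N μ h B) p)
        ∂(positiveLaw N Z A ρ) : ℝ) : EReal) := by
  have := isProbabilityMeasure_uniformLaw hZcomp hZint
  obtain ⟨ε, hε, hb⟩ := exists_latentCritic_mem_Icc (N := N) (B := B) hZcomp hμ hhZ
  have hlim := tendsto_contrastive_loss (ν := uniformLaw Z) (P := positiveLaw N Z A ρ)
    (measurable_latentCritic hh) hε hb
  rw [asymptoticLoss]
  refine Tendsto.limsup_eq ?_
  refine (continuous_coe_real_ereal.tendsto _).comp ?_
  simp only [contrastiveLoss_eq_latent hZcomp hZint hρZ hrh]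
  exact hlim

/-- A minimizer of the asymptotic loss reproduces the conditional density of the current state. -/
theorem normalizedCritic_ae_eq_of_isMinOn [IsProbabilityMeasure ρ] (hZconv : Convex ℝ Z)
    (hZcomp : IsCompact Z) (hZint : (interior Z).Nonempty) (hg : ContinuousOn g Z)
    (hginj : InjOn g Z) (hA : ∀ τ, IsUnit (A τ).det) (hρZ : ∀ᵐ w ∂ρ, ∀ τ, w τ ∈ Z)
    (hμ : 0 < μ) (hμZ : ∀ z ∈ Z, μ • z ∈ Z) {R : Set (EuclideanSpace ℝ (Fin D) → Fin d → ℝ)}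
    (hRexpr : ∀ r : EuclideanSpace ℝ (Fin D) → Fin d → ℝ,
      Continuous r → (∀ x, r x ∈ Z) → r ∈ R)
    (hh : Measurable h) (hhZ : ∀ z, h z ∈ Z) (hrh : ∀ z ∈ Z, r (g z) = h z)
    (hmin : IsMinOn (asymptoticLoss N Z A ρ g μ) (models R) (r, B)) :
    ∀ᵐ w ∂ρ, ∀ᵐ z ∂volume.restrict Z, latentCritic N μ h B w z /
        ∫ x, latentCritic N μ h B w x ∂uniformLaw Z =
      Real.exp (-N (z - transition A w)) /
        ((volume Z)⁻¹.toReal * partitionFn N Z (transition A w)) := by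
  have := isProbabilityMeasure_uniformLaw hZcomp hZint
  -- The competing model `(r', A)` has the true density as its normalized critic. The map `h'`
  -- extends `z ↦ μ • z` to the whole space with values in `Z`, which the uniform critic bounds
  -- need.
  obtain ⟨r', hr'c, hr'Z, hr'⟩ := exists_continuous_encoder hZconv hZcomp hZint hg hginj
    (continuous_const_smul μ) hμZ
  obtain ⟨ret, hretc, hretZ, hret⟩ := exists_continuous_retraction hZconv hZcomp.isClosed hZint
  set h' : (Fin d → ℝ) → Fin d → ℝ := fun z => ret (μ • z)
  have hh' : Measurable h' := (hretc.comp (continuous_const_smul μ)).measurable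
  have hh'Z : ∀ z, h' z ∈ Z := fun z => hretZ _
  have hh'eq : ∀ z ∈ Z, h' z = μ • z := fun z hz => hret _ (hμZ z hz)
  obtain ⟨ε, hε, hb⟩ := exists_latentCritic_mem_Icc (N := N) (B := B) hZcomp hμ hhZ
  obtain ⟨ε', hε', hb'⟩ := exists_latentCritic_mem_Icc (N := N) (B := A) hZcomp hμ hh'Z
  have hpos := positiveLaw_eq_withDensity (N := N) (A := A) hZcomp hZint hρZ hμ hh'eq
  have hc := measurable_latentCritic (N := N) (μ := μ) (B := B) hh
  have hc' := measurable_latentCritic (N := N) (μ := μ) (B := A) hh'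
  have hP : IsProbabilityMeasure (positiveLaw N Z A ρ) := by
    rw [hpos]
    exact isProbabilityMeasure_withDensity_normalizedCritic hc' hε' hb'
  have hle : asymptoticLoss N Z A ρ g μ (r, B) ≤ asymptoticLoss N Z A ρ g μ (r', A) :=
    hmin (show (r', A) ∈ models R from ⟨hRexpr r' hr'c hr'Z, hA⟩)
  rw [asymptoticLoss_eq hZcomp hZint hρZ hμ hh hhZ hrh,
    asymptoticLoss_eq hZcomp hZint hρZ hμ hh' hh'Z fun z hz => (hr' z hz).trans (hh'eq z hz).symm,
    EReal.coe_le_coe_iff, hpos] at hle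
  have hsub : ∀ {δ x : ℝ}, 0 < δ → min ε ε' ≤ δ → x ∈ Icc δ δ⁻¹ →
      x ∈ Icc (min ε ε') (min ε ε')⁻¹ := fun hδ hle hx =>
    ⟨hle.trans hx.1, hx.2.trans (inv_anti₀ (lt_min hε hε') hle)⟩
  have hae := ae_eq_of_integral_log_le (measurable_normalizedCritic hc)
    (measurable_normalizedCritic hc') (lt_min hε hε')
    (fun p => hsub hε (min_le_left _ _) (normalizedCritic_mem_Icc hc hε hb p))
    (fun p => hsub hε' (min_le_right _ _) (normalizedCritic_mem_Icc hc' hε' hb' p))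
    ((integral_normalizedCritic (ρ := ρ) (ν := uniformLaw Z) hc hε hb).trans
      (integral_normalizedCritic hc' hε' hb').symm) hle
  filter_upwards [Measure.ae_ae_of_ae_prod hae, hρZ] with w hw hwZ
  obtain ⟨h3, h4⟩ := integral_latentCritic_of_eqOn (N := N) (A := A) hZcomp hμ hh'eq hwZ
  filter_upwards [(ae_uniformLaw_iff hZcomp hZint).1 hw,
    ae_restrict_mem hZcomp.isClosed.measurableSet] with z hz hzZ
  rw [← h4, ← h3 z hzZ]
  exact hz

end Model

/-! ### From distance profiles to the encoder and the transition. -/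

section Identification

variable {d L D : ℕ} {Z : Set (Fin d → ℝ)} {N : Seminorm ℝ (Fin d → ℝ)}
  {A B : Fin L → Matrix (Fin d) (Fin d) ℝ} {ρ : Measure (Fin L → Fin d → ℝ)} {μ : ℝ}
  {h : (Fin d → ℝ) → Fin d → ℝ}

theorem distance_profile_of_critic_eq (hμ : 0 < μ) {w : Fin L → Fin d → ℝ}
    {y z z' : Fin d → ℝ} {m k : ℝ} (hm : m ≠ 0)
    (hz : latentCritic N μ h B w z / m = Real.exp (-N (z - y)) / k)
    (hz' : latentCritic N μ h B w z' / m = Real.exp (-N (z' - y)) / k) :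
    N (transition B (fun τ => h (w τ)) - h z) - N (transition B (fun τ => h (w τ)) - h z') =
      μ * (N (y - z) - N (y - z')) := by
  set F := transition B (fun τ => h (w τ))
  -- If `k` were `0`, the right side of `hz` would be `0` by convention, while the left side is a
  -- positive number over `m ≠ 0`.
  have hk : k ≠ 0 := by
    rintro rfl
    rw [div_zero, div_eq_zero_iff] at hz
    exact hz.elim (Real.exp_pos _).ne' hm
  rw [div_eq_div_iff hm hk] at hz hz'
  have hc' : latentCritic N μ h B w z' ≠ 0 := (Real.exp_pos _).ne'
  have hmul : latentCritic N μ h B w z * Real.exp (-N (z' - y)) =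
      latentCritic N μ h B w z' * Real.exp (-N (z - y)) := by
    refine mul_right_cancel₀ (mul_ne_zero hm hk) ?_
    calc _ = (latentCritic N μ h B w z * k) * (Real.exp (-N (z' - y)) * m) := by ring
      _ = (Real.exp (-N (z - y)) * m) * (latentCritic N μ h B w z' * k) := by rw [hz, hz']
      _ = _ := by ring
  rw [latentCritic, latentCritic, ← Real.exp_add, ← Real.exp_add, Real.exp_eq_exp,
    map_sub_rev N z, map_sub_rev N z'] at hmul
  change -N (F - h z) / μ + _ = -N (F - h z') / μ + _ at hmul
  field_simp at hmul
  linarith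

/-- Write `F = U (y + e) + b` and compare the states `y + t • e` and `y`: moving towards `F` lowers
the left side by `t * μ * N e`, while the right side grows by the same amount, so `e = 0`.
Interiority of `y` keeps `y + t • e` in `Z` for small `t`. -/
theorem eq_of_distance_profiles (hN : ∀ x, N x = 0 → x = 0) (hμ : 0 < μ)
    {U : (Fin d → ℝ) →ₗ[ℝ] (Fin d → ℝ)} (hU : ∀ x, N (U x) = μ * N x) {b F y : Fin d → ℝ}
    (hy : y ∈ interior Z) {S : Set (Fin d → ℝ)} (hS : Z ⊆ closure S)
    (hprof : ∀ z ∈ S, ∀ z' ∈ S,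
      N (F - (U z + b)) - N (F - (U z' + b)) = μ * (N (y - z) - N (y - z'))) : F = U y + b := by
  have hNc := seminorm_continuous N
  have hUc : Continuous U := U.continuous_of_finiteDimensional
  have hext : ∀ z ∈ Z, ∀ z' ∈ Z,
      N (F - (U z + b)) - N (F - (U z' + b)) = μ * (N (y - z) - N (y - z')) := by
    intro z hz z' hz'
    have hmem : (z, z') ∈ closure (S ×ˢ S) := by rw [closure_prod_eq]; exact ⟨hS hz, hS hz'⟩
    have hcl : IsClosed {q : (Fin d → ℝ) × (Fin d → ℝ) |
        N (F - (U q.1 + b)) - N (F - (U q.2 + b)) = μ * (N (y - q.1) - N (y - q.2))} :=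
      isClosed_eq (by fun_prop) (by fun_prop)
    exact closure_minimal (fun q hq => hprof _ hq.1 _ hq.2) hcl hmem
  have hinj : Function.Injective U := (injective_iff_map_eq_zero U).2 fun x hx => hN x (by
    have := hU x
    rw [hx, map_zero, zero_eq_mul] at this
    exact this.resolve_left hμ.ne')
  obtain ⟨e, he⟩ := LinearMap.injective_iff_surjective.1 hinj (F - (U y + b))
  have hyZ := interior_subset hy
  have hlim : Tendsto (fun n : ℕ => y + (1 / ((n : ℝ) + 1)) • e) atTop (𝓝 y) := by
    have := (tendsto_one_div_add_atTop_nhds_zero_nat (𝕜 := ℝ)).smul_const e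
    simpa using this.const_add y
  obtain ⟨n, hn⟩ := (hlim.eventually (mem_interior_iff_mem_nhds.1 hy)).exists
  set t : ℝ := 1 / ((n : ℝ) + 1)
  have ht0 : 0 < t := by positivity
  have ht1 : t ≤ 1 := by
    simp only [t]
    rw [div_le_one (by positivity)]
    have : (0 : ℝ) ≤ n := by positivity
    linarith
  have h1 := hext _ hn y hyZ
  have h2 : F - (U (y + t • e) + b) = (1 - t) • U e := by
    rw [he, map_add, map_smul, he]; module
  rw [h2, ← he, map_smul_eq_mul, hU, sub_self, map_zero, show y - (y + t • e) = (-t) • e by module,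
    map_smul_eq_mul, Real.norm_eq_abs, Real.norm_eq_abs, abs_neg, abs_of_pos ht0,
    abs_of_nonneg (by linarith), sub_zero] at h1
  have h3 : t * μ * N e = 0 := by linarith
  have h4 : N e = 0 := (mul_eq_zero.1 h3).resolve_left (by positivity)
  rw [hN e h4, map_zero] at he
  exact sub_eq_zero.1 he.symm

theorem mem_interior_ae_restrict (hZconv : Convex ℝ Z) (hZcomp : IsCompact Z) :
    ∀ᵐ z ∂volume.restrict Z, z ∈ interior Z := by
  have h1 : ∀ᵐ z ∂volume.restrict Z, z ∉ frontier Z :=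
    ae_restrict_of_ae (measure_eq_zero_iff_ae_notMem.1 (hZconv.addHaar_frontier volume))
  filter_upwards [h1, ae_restrict_mem hZcomp.isClosed.measurableSet] with z hz hzZ
  rw [← self_sdiff_frontier]
  exact ⟨hzZ, hz⟩

theorem subset_closure_transition_image (hZconv : Convex ℝ Z) (hZcomp : IsCompact Z)
    (hZint : (interior Z).Nonempty) (hρunif : ρ.map (transition A) = uniformLaw Z)
    {G : Set (Fin L → Fin d → ℝ)} (hG : ∀ᵐ w ∂ρ, w ∈ G) :
    Z ⊆ closure (transition A '' G) := by
  have hae : ∀ᵐ y ∂ρ.map (transition A), y ∈ closure (transition A '' G) :=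
    (ae_map_iff (continuous_transition A).aemeasurable isClosed_closure.measurableSet).2
      (hG.mono fun w hw => subset_closure ⟨w, hw, rfl⟩)
  rw [hρunif, ae_uniformLaw_iff hZcomp hZint] at hae
  exact (subset_closure_of_ae_restrict volume hZconv hZint hae).trans
    (closure_minimal inter_subset_left isClosed_closure)

theorem ae_transition_mem (hZcomp : IsCompact Z) (hZint : (interior Z).Nonempty)
    (hρunif : ρ.map (transition A) = uniformLaw Z) {S : Set (Fin d → ℝ)} (hS : MeasurableSet S)
    (hSZ : ∀ᵐ z ∂volume.restrict Z, z ∈ S) : ∀ᵐ w ∂ρ, transition A w ∈ S := by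
  have h1 : ∀ᵐ y ∂ρ.map (transition A), y ∈ S := by
    rw [hρunif]
    exact (ae_uniformLaw_iff hZcomp hZint).2 hSZ
  exact (ae_map_iff (continuous_transition A).aemeasurable hS).1 h1

/-- An encoder whose critic has, for almost all histories, the distance profile of the noiseless
transition is affine up to a null set. -/
theorem exists_linear_ae_eq_of_profiles (hZconv : Convex ℝ Z)
    (hZcomp : IsCompact Z) (hZint : (interior Z).Nonempty) (hN : ∀ x, N x = 0 → x = 0)
    (hρunif : ρ.map (transition A) = uniformLaw Z) (hμ : 0 < μ) (hhZ : ∀ z, h z ∈ Z)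
    (hprof : ∀ᵐ w ∂ρ, ∃ S : Set (Fin d → ℝ), (∀ᵐ z ∂volume.restrict Z, z ∈ S) ∧ ∀ z ∈ S, ∀ z' ∈ S,
      N (transition B (fun τ => h (w τ)) - h z) - N (transition B (fun τ => h (w τ)) - h z') =
        μ * (N (transition A w - z) - N (transition A w - z'))) :
    ∃ (U : (Fin d → ℝ) →ₗ[ℝ] (Fin d → ℝ)) (b : Fin d → ℝ), (∀ x, N (U x) = μ * N x) ∧
      MapsTo (fun z => U z + b) Z Z ∧ ∀ᵐ z ∂volume.restrict Z, h z = U z + b := by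
  have hZm := hZcomp.isClosed.measurableSet
  have hTZ : ∀ᵐ w ∂ρ, transition A w ∈ Z :=
    ae_transition_mem hZcomp hZint hρunif hZm (ae_restrict_mem hZm)
  set G : Set (Fin L → Fin d → ℝ) := {w | transition A w ∈ Z ∧
    ∃ S : Set (Fin d → ℝ), (∀ᵐ z ∂volume.restrict Z, z ∈ S) ∧ ∀ z ∈ S, ∀ z' ∈ S,
      N (transition B (fun τ => h (w τ)) - h z) - N (transition B (fun τ => h (w τ)) - h z') =
        μ * (N (transition A w - z) - N (transition A w - z'))}
  have hG : Z ⊆ closure (transition A '' G) :=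
    subset_closure_transition_image hZconv hZcomp hZint hρunif (hTZ.and hprof)
  -- Each history has its own exceptional null set of states. Restricting to countably many
  -- histories with dense transitions leaves one common full-measure set `T`.
  obtain ⟨Y, hYsub, hYc, hYd⟩ :=
    (TopologicalSpace.IsSeparable.of_separableSpace
      (transition A '' G)).exists_countable_dense_subset
  have hchoose : ∀ y, ∃ (F : Fin d → ℝ) (S : Set (Fin d → ℝ)), y ∈ Y → F ∈ transition B '' (univ.pi fun _ : Fin L => Z) ∧
      (∀ᵐ z ∂volume.restrict Z, z ∈ S) ∧ ∀ z ∈ S, ∀ z' ∈ S,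
        N (F - h z) - N (F - h z') = μ * (N (y - z) - N (y - z')) := by
    intro y
    by_cases hy : y ∈ Y
    · obtain ⟨w, ⟨-, S, hS, hSprof⟩, rfl⟩ := hYsub hy
      exact ⟨_, S, fun _ => ⟨⟨_, fun τ _ => hhZ (w τ), rfl⟩, hS, hSprof⟩⟩
    · exact ⟨0, ∅, fun h => absurd h hy⟩
  choose F S hFS using hchoose
  set T : Set (Fin d → ℝ) := {z | ∀ y ∈ Y, z ∈ S y}
  have hT : ∀ᵐ z ∂volume.restrict Z, z ∈ T := (ae_ball_iff hYc).2 fun y hy => (hFS y hy).2.1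
  obtain ⟨U, b, hU, hUZ, hUT⟩ := exists_linear_of_distance_profiles hN hμ hZconv hZcomp hZint
    (h := h) (S := T ∩ Z) (Y := Y) inter_subset_right
    (subset_closure_of_ae_restrict volume hZconv hZint hT) (fun z _ => hhZ z)
    (fun y hy => by
      obtain ⟨w, hw, rfl⟩ := hYsub hy
      exact hw.1)
    (hG.trans (closure_minimal hYd isClosed_closure))
    ((isCompact_univ_pi fun _ => hZcomp).image (continuous_transition B))
    (fun y hy => ⟨F y, (hFS y hy).1, fun z hz z' hz' =>
      (hFS y hy).2.2 z (hz.1 y hy) z' (hz'.1 y hy)⟩)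
  refine ⟨U, b, hU, hUZ, ?_⟩
  filter_upwards [hT, ae_restrict_mem hZm] with z hz hzZ using hUT z ⟨hz, hzZ⟩

/-- The transition as a linear map of the history. -/
def transitionHom (A : Fin L → Matrix (Fin d) (Fin d) ℝ) :
    (Fin L → Fin d → ℝ) →ₗ[ℝ] (Fin d → ℝ) :=
  ∑ τ, (A τ).mulVecLin ∘ₗ LinearMap.proj τ

theorem transitionHom_apply (w : Fin L → Fin d → ℝ) : transitionHom A w = transition A w := by
  simp [transitionHom, transition]

theorem transition_add (v w : Fin L → Fin d → ℝ) :
    transition A (fun τ => v τ + w τ) = transition A v + transition A w := by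
  simp only [← transitionHom_apply]
  exact map_add (transitionHom A) v w

theorem transition_single (τ : Fin L) (v : Fin d → ℝ) :
    transition A (Pi.single τ v) = A τ *ᵥ v := by
  rw [transition, Finset.sum_eq_single τ (fun σ _ hσ => by simp [hσ]) (by simp), Pi.single_eq_same]

/-- Two affine maps that agree almost everywhere for a nonzero absolutely continuous measure
agree everywhere. -/
theorem affine_eq_zero_of_ae {E F : Type*} [NormedAddCommGroup E] [NormedSpace ℝ E]
    [FiniteDimensional ℝ E] [MeasurableSpace E] [BorelSpace E] {m ρ : Measure E}
    [m.IsAddHaarMeasure] [IsProbabilityMeasure ρ] (hac : ρ ≪ m) [AddCommGroup F] [Module ℝ F]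
    (l : E →ₗ[ℝ] F) (k : F) (hae : ∀ᵐ w ∂ρ, l w + k = 0) (w : E) : l w + k = 0 := by
  set S : AffineSubspace ℝ E :=
    { carrier := {w | l w + k = 0}
      smul_vsub_vadd_mem' := fun c p₁ p₂ p₃ h₁ h₂ h₃ => by
        simp only [mem_ofPred_eq] at h₁ h₂ h₃ ⊢
        rw [vsub_eq_sub, vadd_eq_add, map_add, map_smul, map_sub, eq_neg_of_add_eq_zero_left h₁,
          eq_neg_of_add_eq_zero_left h₂, sub_self, smul_zero, zero_add, h₃] }
  have hS : (w : E) ∈ (S : Set E) ↔ l w + k = 0 := Iff.rfl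
  by_contra hw
  have hne : S ≠ ⊤ := fun h => hw (hS.1 (by rw [h]; trivial))
  have h0 : ρ (S : Set E) = 0 := hac (Measure.addHaar_affineSubspace m S hne)
  have h1 : ∀ᵐ w ∂ρ, False := by
    filter_upwards [hae, measure_eq_zero_iff_ae_notMem.1 h0] with v hv hv'
    exact hv' hv
  exact (h1.exists).elim fun _ h => h

/-- Absolute continuity of `ρ` enters twice: every past state avoids the null set where `h` is not
affine, and the almost sure identity between affine functions of the history extends to all
histories. -/
theorem transition_affine_encoder [IsProbabilityMeasure ρ] (hZconv : Convex ℝ Z)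
    (hZcomp : IsCompact Z) (hZint : (interior Z).Nonempty) (hN : ∀ x, N x = 0 → x = 0)
    (hρZ : ∀ᵐ w ∂ρ, ∀ τ, w τ ∈ Z) (hρac : ρ ≪ volume)
    (hρunif : ρ.map (transition A) = uniformLaw Z) (hμ : 0 < μ)
    (hprof : ∀ᵐ w ∂ρ, ∃ S : Set (Fin d → ℝ), (∀ᵐ z ∂volume.restrict Z, z ∈ S) ∧ ∀ z ∈ S, ∀ z' ∈ S,
      N (transition B (fun τ => h (w τ)) - h z) - N (transition B (fun τ => h (w τ)) - h z') =
        μ * (N (transition A w - z) - N (transition A w - z')))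
    {U : (Fin d → ℝ) →ₗ[ℝ] (Fin d → ℝ)} {b : Fin d → ℝ} (hU : ∀ x, N (U x) = μ * N x)
    (hhU : ∀ᵐ z ∂volume.restrict Z, h z = U z + b) (w : Fin L → Fin d → ℝ) :
    transition B (fun τ => U (w τ) + b) = U (transition A w) + b := by
  have hZm := hZcomp.isClosed.measurableSet
  have hhw : ∀ᵐ w ∂ρ, ∀ τ, h (w τ) = U (w τ) + b := by
    have h1 : ∀ᵐ w : Fin L → Fin d → ℝ, ∀ τ, w τ ∈ Z → h (w τ) = U (w τ) + b :=
      ae_all_iff.2 fun τ => (Measure.quasiMeasurePreserving_eval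
        (fun _ : Fin L => (volume : Measure (Fin d → ℝ))) τ).ae ((ae_restrict_iff' hZm).1 hhU)
    filter_upwards [hρac.ae_le h1, hρZ] with w hw hwZ τ using hw τ (hwZ τ)
  have hTint : ∀ᵐ w ∂ρ, transition A w ∈ interior Z :=
    ae_transition_mem hZcomp hZint hρunif isOpen_interior.measurableSet
      (mem_interior_ae_restrict hZconv hZcomp)
  have hae : ∀ᵐ w ∂ρ, transition B (fun τ => U (w τ) + b) = U (transition A w) + b := by
    filter_upwards [hprof, hhw, hTint] with w hw hwh hwint
    obtain ⟨S, hS, hSprof⟩ := hw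
    simp only [hwh] at hSprof
    refine eq_of_distance_profiles hN hμ hU hwint
      (subset_closure_of_ae_restrict volume hZconv hZint (hS.and hhU)) ?_
    rintro z ⟨⟨hz, hzU⟩, -⟩ z' ⟨⟨hz', hzU'⟩, -⟩
    have := hSprof z hz z' hz'
    rwa [hzU, hzU'] at this
  have hsplit : ∀ w : Fin L → Fin d → ℝ, (transitionHom B ∘ₗ LinearMap.pi
      (fun τ => U ∘ₗ LinearMap.proj τ) - U ∘ₗ transitionHom A) w +
        (transition B (fun _ => b) - b) =
      transition B (fun τ => U (w τ) + b) - (U (transition A w) + b) := by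
    intro w
    have h1 : transition B (fun τ => U (w τ) + b) =
        transition B (fun τ => U (w τ)) + transition B (fun _ => b) :=
      transition_add (fun τ => U (w τ)) fun _ => b
    rw [h1, LinearMap.sub_apply, LinearMap.comp_apply, LinearMap.comp_apply, transitionHom_apply,
      transitionHom_apply]
    change transition B (fun τ => U (w τ)) - _ + _ = _
    abel
  have := affine_eq_zero_of_ae hρac _ _ (hae.mono fun w hw => by
    rw [hsplit w, hw, sub_self]) w
  rw [hsplit w] at this
  exact sub_eq_zero.1 this

/-- By change of variables an affine bijection of `Z` fixes its barycentre, and here the image of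
the origin is `b`. -/
theorem translation_eq_zero_of_barycenter (hZcomp : IsCompact Z) (hZint : (interior Z).Nonempty)
    {U : (Fin d → ℝ) →ₗ[ℝ] (Fin d → ℝ)} {b : Fin d → ℝ} (hinj : Function.Injective U)
    (himage : (fun z => U z + b) '' Z = Z) (hbar : ∫ z in Z, z = 0) : b = 0 := by
  have hZm := hZcomp.isClosed.measurableSet
  obtain ⟨h0, ht⟩ := measure_convexBody_ne hZcomp hZint
  set V := LinearMap.toContinuousLinearMap U
  have hid : IntegrableOn (fun z : Fin d → ℝ => z) Z := continuousOn_id.integrableOn_compact hZcomp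
  have h := integral_image_eq_integral_abs_det_fderiv_smul volume hZm
    (f := fun z => U z + b) (f' := fun _ => V)
    (fun x _ => (V.hasFDerivAt.add_const b).hasFDerivWithinAt)
    (fun x _ y _ hxy => hinj (add_right_cancel hxy)) (fun z => z)
  rw [himage, hbar, integral_smul] at h
  have hdet : |V.det| ≠ 0 := by
    rw [abs_ne_zero]
    change LinearMap.det U ≠ 0
    exact ((LinearMap.isUnit_iff_ker_eq_bot U).2 (LinearMap.ker_eq_bot.2 hinj)).map
      LinearMap.det |>.ne_zero
  have h1 : ∫ z in Z, (U z + b) = 0 := (smul_eq_zero.1 h.symm).resolve_left hdet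
  have h2 : ∫ z in Z, V z = 0 := by
    rw [V.integral_comp_comm hid, hbar, map_zero]
  have hVU : ∀ z, V z = U z := fun _ => rfl
  have h3 : ∫ z in Z, (V z + b) = (∫ z in Z, V z) + ∫ _ in Z, b :=
    integral_add (V.integrable_comp hid) (integrableOn_const ht)
  simp only [← hVU] at h1
  rw [h1, h2, zero_add, setIntegral_const] at h3
  exact (smul_eq_zero.1 h3.symm).resolve_left (ENNReal.toReal_ne_zero.2 ⟨h0, ht⟩)

theorem exists_profile_of_isMinOn [IsProbabilityMeasure ρ]
    {g : (Fin d → ℝ) → EuclideanSpace ℝ (Fin D)} {r : EuclideanSpace ℝ (Fin D) → Fin d → ℝ}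
    (hZconv : Convex ℝ Z)
    (hZcomp : IsCompact Z) (hZint : (interior Z).Nonempty) (hg : ContinuousOn g Z)
    (hginj : InjOn g Z) (hA : ∀ τ, IsUnit (A τ).det) (hρZ : ∀ᵐ w ∂ρ, ∀ τ, w τ ∈ Z)
    (hμ : 0 < μ) (hμZ : ∀ z ∈ Z, μ • z ∈ Z) {R : Set (EuclideanSpace ℝ (Fin D) → Fin d → ℝ)}
    (hRexpr : ∀ r : EuclideanSpace ℝ (Fin D) → Fin d → ℝ,
      Continuous r → (∀ x, r x ∈ Z) → r ∈ R)
    (hh : Measurable h) (hhZ : ∀ z, h z ∈ Z) (hrh : ∀ z ∈ Z, r (g z) = h z)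
    (hmin : IsMinOn (asymptoticLoss N Z A ρ g μ) (models R) (r, B)) :
    ∀ᵐ w ∂ρ, ∃ S : Set (Fin d → ℝ), (∀ᵐ z ∂volume.restrict Z, z ∈ S) ∧ ∀ z ∈ S, ∀ z' ∈ S,
      N (transition B (fun τ => h (w τ)) - h z) - N (transition B (fun τ => h (w τ)) - h z') =
        μ * (N (transition A w - z) - N (transition A w - z')) := by
  have := isProbabilityMeasure_uniformLaw hZcomp hZint
  obtain ⟨ε, hε, hb⟩ := exists_latentCritic_mem_Icc (N := N) (B := B) hZcomp hμ hhZ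
  filter_upwards [normalizedCritic_ae_eq_of_isMinOn hZconv hZcomp hZint hg hginj hA hρZ hμ hμZ
    hRexpr hh hhZ hrh hmin] with w hw
  exact ⟨_, hw, fun z hz z' hz' => distance_profile_of_critic_eq hμ
    (hε.trans_le (integral_critic_mem_Icc (measurable_latentCritic hh) hb w).1).ne' hz hz'⟩

end Identification

end ContrastiveVAR

end

/-! ### The main theorem. -/

theorem theorem1 {d L D : ℕ}
    -- the latent space: a convex body
    (Z : Set (Fin d → ℝ)) (hZconv : Convex ℝ Z) (hZcomp : IsCompact Z)
    (hZint : (interior Z).Nonempty)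
    -- the norm inducing the metric
    (N : Seminorm ℝ (Fin d → ℝ)) (hN : ∀ x, N x = 0 → x = 0)
    -- the generator
    (g : (Fin d → ℝ) → EuclideanSpace ℝ (Fin D))
    (hgdiff : DifferentiableOn ℝ g Z) (hginj : InjOn g Z)
    -- the ground-truth transition matrices and the law of the history
    (A : Fin L → Matrix (Fin d) (Fin d) ℝ) (hA : ∀ τ, IsUnit (A τ).det)
    (ρ : Measure (Fin L → Fin d → ℝ)) [IsProbabilityMeasure ρ]
    (hρZ : ∀ᵐ w ∂ρ, ∀ τ, w τ ∈ Z) (hρac : ρ ≪ volume)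
    (hρunif : ρ.map (ContrastiveVAR.transition A) = ContrastiveVAR.uniformLaw Z)
    -- the temperature
    (μ : ℝ) (hμ : 0 < μ) (hμZ : ∀ z ∈ Z, μ • z ∈ Z)
    -- the class of encoders
    (R : Set (EuclideanSpace ℝ (Fin D) → Fin d → ℝ))
    (hR : ∀ r ∈ R, Measurable r ∧ ∀ x, r x ∈ Z)
    (hRexpr : ∀ r : EuclideanSpace ℝ (Fin D) → Fin d → ℝ,
      Continuous r → (∀ x, r x ∈ Z) → r ∈ R)
    -- a minimizer of the contrastive objective
    (r : EuclideanSpace ℝ (Fin D) → Fin d → ℝ) (B : Fin L → Matrix (Fin d) (Fin d) ℝ)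
    (hmem : (r, B) ∈ ContrastiveVAR.models R)
    (hmin : IsMinOn (ContrastiveVAR.asymptoticLoss N Z A ρ g μ)
      (ContrastiveVAR.models R) (r, B)) :
    ∃ (U : Matrix (Fin d) (Fin d) ℝ) (b : Fin d → ℝ),
      -- `h = r ∘ g` is an invertible affine map, a similarity of ratio `μ`
      IsUnit U.det ∧ (∀ x, N (U *ᵥ x) = μ * N x) ∧
      MapsTo (fun z => U *ᵥ z + b) Z Z ∧
      (∀ᵐ z ∂(volume.restrict Z), r (g z) = U *ᵥ z + b) ∧
      (ContinuousOn (fun z => r (g z)) Z → ∀ z ∈ Z, r (g z) = U *ᵥ z + b) ∧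
      (μ = 1 → BijOn (fun z => U *ᵥ z + b) Z Z) ∧
      (μ = 1 → (∫ z in Z, z) = 0 → b = 0) ∧
      -- for the `ℓ^p` norms the linear part is orthogonal up to the scale `μ`
      (∀ p : ℝ≥0∞, 1 ≤ p → (∀ x, N x = ‖WithLp.toLp p x‖) →
        μ⁻¹ • U ∈ Matrix.orthogonalGroup (Fin d) ℝ) ∧
      -- the learned transition is the ground-truth transition in the new coordinates
      (∀ τ, B τ = U * A τ * U⁻¹) ∧
      (∀ w : Fin L → Fin d → ℝ,
        ContrastiveVAR.transition B (fun τ => U *ᵥ w τ + b) =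
          U *ᵥ ContrastiveVAR.transition A w + b) := by
  have hg : ContinuousOn g Z := hgdiff.continuousOn
  have hZm := hZcomp.isClosed.measurableSet
  classical
  -- The generator is controlled only on `Z`; replacing it by a constant elsewhere makes `h`
  -- measurable on the whole space.
  set h : (Fin d → ℝ) → Fin d → ℝ := fun z => r (Z.piecewise g (fun _ => 0) z)
  have hh : Measurable h :=
    (hR r hmem.1).1.comp (hg.measurable_piecewise continuousOn_const hZm)
  have hhZ : ∀ z, h z ∈ Z := fun z => (hR r hmem.1).2 _
  have hrh : ∀ z ∈ Z, r (g z) = h z := fun z hz => by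
    simp only [h, Set.piecewise_eq_of_mem _ _ _ hz]
  have hprof := ContrastiveVAR.exists_profile_of_isMinOn hZconv hZcomp hZint hg hginj hA hρZ hμ
    hμZ hRexpr hh hhZ hrh hmin
  obtain ⟨U, b, hU, hUZ, hhU⟩ := ContrastiveVAR.exists_linear_ae_eq_of_profiles hZconv hZcomp
    hZint hN hρunif hμ hhZ hprof
  have htrans := ContrastiveVAR.transition_affine_encoder hZconv hZcomp hZint hN hρZ hρac hρunif
    hμ hprof hU hhU
  have hinj : Function.Injective U := (injective_iff_map_eq_zero U).2 fun x hx => hN x (by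
    have := hU x
    rw [hx, map_zero, zero_eq_mul] at this
    exact this.resolve_left hμ.ne')
  set V : Matrix (Fin d) (Fin d) ℝ := LinearMap.toMatrix' U
  have hVU : ∀ x, V *ᵥ x = U x := fun x => LinearMap.toMatrix'_mulVec U x
  have hVunit : IsUnit V.det := by
    rw [← Matrix.isUnit_iff_isUnit_det, ← Matrix.mulVec_injective_iff_isUnit]
    exact fun x y hxy => hinj (by simpa only [hVU] using hxy)
  have hUae : ∀ᵐ z ∂volume.restrict Z, r (g z) = U z + b := by
    filter_upwards [hhU, ae_restrict_mem hZm] with z hz hzZ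
    rw [hrh z hzZ, hz]
  have hbij : μ = 1 → BijOn (fun z => U z + b) Z Z := by
    intro h1
    refine ⟨hUZ, fun x _ y _ hxy => hinj (add_right_cancel hxy),
      ContrastiveVAR.surjOn_of_isometric hN hZcomp hUZ fun x _ y _ => ?_⟩
    rw [add_sub_add_right_eq_sub, ← map_sub, hU, h1, one_mul]
  refine ⟨V, b, hVunit, by simpa only [hVU] using hU, by simpa only [hVU] using hUZ,
    by simpa only [hVU] using hUae, fun hcont => ?_, by simpa only [hVU] using hbij,
    fun h1 hbar => ContrastiveVAR.translation_eq_zero_of_barycenter hZcomp hZint hinj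
      (hbij h1).image_eq hbar, fun p hp hNp => ?_, ?_, by simpa only [hVU] using htrans⟩
  · have hd := ContrastiveVAR.subset_closure_of_ae_restrict volume hZconv hZint
      (S := {z | r (g z) = U z + b}) hUae
    have hUc : Continuous U := U.continuous_of_finiteDimensional
    have := Set.EqOn.of_subset_closure (f := fun z => r (g z)) (g := fun z => U z + b)
      (fun z hz => hz.1) hcont (by fun_prop) inter_subset_right hd
    intro z hz
    rw [hVU]
    exact this hz
  · refine ContrastiveVAR.mem_orthogonalGroup_of_isometry hN (fun x y hxy => ?_)
      (fun x σ => ?_) _ fun x => ?_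
    · rw [hNp, hNp]
      exact ContrastiveVAR.norm_toLp_eq_of_abs_eq hp hxy
    · rw [hNp, hNp]
      exact ContrastiveVAR.norm_toLp_comp_perm hp x σ
    · rw [Matrix.smul_mulVec, hVU, map_smul_eq_mul, hU, Real.norm_eq_abs,
        abs_of_pos (inv_pos.2 hμ), inv_mul_cancel_left₀ hμ.ne']
  · intro τ
    have h0 := htrans 0
    have hcomm : B τ * V = V * A τ := by
      refine Matrix.ext_iff_mulVec.2 fun v => ?_
      -- Subtracting the identity for the zero history removes the translation and isolates the
      -- `τ`-th matrices.
      have h1 := htrans (Pi.single τ v)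
      have hsplit : (fun σ => U ((Pi.single τ v : Fin L → Fin d → ℝ) σ) + b) =
          fun σ => (Pi.single τ (U v) : Fin L → Fin d → ℝ) σ +
            (U ((0 : Fin L → Fin d → ℝ) σ) + b) := by
        funext σ
        rcases eq_or_ne σ τ with rfl | hσ <;> simp [*]
      have hA0 : ContrastiveVAR.transition A 0 = 0 := by simp [ContrastiveVAR.transition]
      rw [hsplit, ContrastiveVAR.transition_add, ContrastiveVAR.transition_single,
        ContrastiveVAR.transition_single, h0, hA0, map_zero, zero_add] at h1
      rw [← Matrix.mulVec_mulVec, ← Matrix.mulVec_mulVec, hVU, hVU]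
      exact add_right_cancel h1
    rw [← hcomm, Matrix.mul_nonsing_inv_cancel_right _ _ hVunit]
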